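/- **Proposition.** Conventions: for a Banach $*$-algebra $\mathcal A$ (isometric involution) let $C^*(\mathcal A)$ be its enveloping $C^*$-algebra, i.e. the Hausdorff completion of $\mathcal A$ with respect to the $C^*$-seminorm $|a|_*=\sup_\pi\|\pi(a)\|$, the supremum being taken over all $*$-representations $\pi$ of $\mathcal A$ on Hilbert spaces. "Ideal" means closed two-sided ideal. For an ideal $I$ of $C^*(\mathcal A)$ let $I\cap\mathcal A$ denote its preimage under the natural map $\mathcal A\to C^*(\mathcal A)$. The ideal $I$ is called *$\mathcal A$-determined* if for every ideal $J$ of $C^*(\mathcal A)$ the inclusion $I\cap\mathcal A\subset J\cap\mathcal A$ implies $I\subset J$. The algebra $\mathcal A$ is called *$*$-regular* if every ideal of $C^*(\mathcal A)$ is $\mathcal A$-determined. A (Hausdorff) locally compact group $G$ is called $*$-regular if its group algebra $L^1(G)$ (left Haar measure, convolution, $f^*(x)=\Delta_G(x^{-1})\overline{f(x^{-1})}$) is $*$-regular, and $C^*(G)=C^*(L^1(G))$. If $H$ is a closed subgroup of $G$, the convolution $(a*f)(x)=\int_H a(h)f(h^{-1}x)\,dh$ of $a\in L^1(H)$ and $f\in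 L^1(G)$ extends by continuity to an action $C^*(H)\times C^*(G)\to C^*(G)$, $(a,f)\mapsto a*f$. An ideal $I$ of $C^*(G)$ is *induced from $H$* if there is an ideal $J$ of $C^*(H)$ such that $$I=\bigl(C^*(G)*J*C^*(G)\bigr)^{-},$$ the closed linear span of all $f*(a*g)$ with $f,g\in C^*(G)$ and $a\in J$. **Statement.** Let $G$ be a locally compact group and let $H$ be a $*$-regular closed subgroup of $G$. If an ideal $I$ of $C^*(G)$ is induced from $H$, then $I$ is $L^1(G)$-determined. -/

import Mathlib

open MeasureTheory MeasureTheory.Measure Set Filter Topology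
open scoped ENNReal NNReal ComplexConjugate

set_option linter.unusedSectionVars false

universe u

noncomputable section
namespace GroupCStar

theorem regular_withDensity {X : Type*} [TopologicalSpace X] [LocallyCompactSpace X] [T2Space X]
    [MeasurableSpace X] [BorelSpace X] (μ : Measure X) [μ.Regular] {ρ : X → ℝ≥0}
    (hc : Continuous ρ) (hpos : ∀ x, 0 < ρ x) :
    (μ.withDensity fun x => (ρ x : ℝ≥0∞)).Regular := by
  set ν := μ.withDensity fun x => (ρ x : ℝ≥0∞) with hν
  have hm : Measurable fun x => (ρ x : ℝ≥0∞) := by fun_prop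
  let V : ℕ → Set X := fun n => {x | ((n : ℝ≥0) + 1)⁻¹ < ρ x ∧ ρ x < (n : ℝ≥0) + 1}
  have hVo : ∀ n, IsOpen (V n) := by
    intro n
    have h1 : IsOpen {x | ((n : ℝ≥0) + 1)⁻¹ < ρ x} := isOpen_lt continuous_const hc
    have h2 : IsOpen {x | ρ x < (n : ℝ≥0) + 1} := isOpen_lt hc continuous_const
    exact h1.inter h2
  have hVmono : Monotone V := by
    intro m n hmn x hx
    have h1 : (m : ℝ≥0) + 1 ≤ n + 1 := by gcongr
    refine ⟨lt_of_le_of_lt ?_ hx.1, hx.2.trans_le h1⟩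
    exact inv_anti₀ (by positivity) h1
  have hVU : ∀ x, ∃ n, x ∈ V n := by
    intro x
    obtain ⟨n, hn⟩ := exists_nat_gt (max (ρ x) (ρ x)⁻¹)
    refine ⟨n, ?_, ?_⟩
    · have : (ρ x)⁻¹ < (n : ℝ≥0) + 1 := (le_max_right _ _).trans_lt (hn.trans (by simp))
      exact inv_lt_of_inv_lt₀ (hpos x) this
    · exact (le_max_left _ _).trans_lt (hn.trans (by simp))
  have hup : ∀ n s, MeasurableSet s → s ⊆ V n → ν s ≤ ((n : ℝ≥0) + 1 : ℝ≥0) * μ s := by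
    intro n s hs hsV
    rw [hν, withDensity_apply _ hs, ← setLIntegral_const]
    exact setLIntegral_mono measurable_const fun x hx => by exact_mod_cast (hsV hx).2.le
  have hlow : ∀ n s, MeasurableSet s → s ⊆ V n → (((n : ℝ≥0) + 1)⁻¹ : ℝ≥0) * μ s ≤ ν s := by
    intro n s hs hsV
    rw [hν, withDensity_apply _ hs, ← setLIntegral_const]
    exact setLIntegral_mono hm fun x hx => by exact_mod_cast (hsV hx).1.le
  have hpos' : ∀ n : ℕ, (((n : ℝ≥0) + 1 : ℝ≥0) : ℝ≥0∞) ≠ 0 := fun n => by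
    exact_mod_cast (by positivity : ((n : ℝ≥0) + 1) ≠ 0)
  have hpos'' : ∀ n : ℕ, ((((n : ℝ≥0) + 1)⁻¹ : ℝ≥0) : ℝ≥0∞) ≠ 0 := fun n => by
    exact_mod_cast (by positivity : ((n : ℝ≥0) + 1)⁻¹ ≠ 0)
  have hcpt : ∀ K : Set X, IsCompact K → ν K < ∞ := by
    intro K hK
    obtain ⟨n, hn⟩ := hK.elim_directed_cover V hVo (fun x _ => mem_iUnion.2 (hVU x))
      hVmono.directed_le
    exact (hup n K hK.measurableSet hn).trans_lt
      (ENNReal.mul_lt_top ENNReal.coe_lt_top hK.measure_lt_top)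
  refine { lt_top_of_isCompact := fun K hK => hcpt K hK, outerRegular := ?_, innerRegular := ?_ }
  · intro A hA r hr
    obtain ⟨ε, hε, hsum⟩ := ENNReal.exists_pos_sum_of_countable
      (tsub_pos_of_lt hr).ne' ℕ
    have hBm : ∀ n, MeasurableSet (A ∩ V n) := fun n => hA.inter (hVo n).measurableSet
    have hBfin : ∀ n, μ (A ∩ V n) ≠ ∞ := by
      intro n htop
      have := hlow n _ (hBm n) inter_subset_right
      rw [htop, ENNReal.mul_top (hpos'' n), top_le_iff] at this
      exact (lt_of_le_of_lt (measure_mono inter_subset_left) hr).ne_top this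
    have hex : ∀ n, ∃ U ⊇ A ∩ V n, IsOpen U ∧ U ⊆ V n ∧ ν (U \ (A ∩ V n)) ≤ ε n := by
      intro n
      obtain ⟨U, hU, hUo, -, hlt⟩ := (hBm n).exists_isOpen_sdiff_lt (hBfin n)
        (ε := (ε n : ℝ≥0∞) / ((n : ℝ≥0) + 1 : ℝ≥0))
        (ENNReal.div_pos (by exact_mod_cast (hε n).ne') ENNReal.coe_ne_top).ne'
      refine ⟨U ∩ V n, subset_inter hU inter_subset_right, hUo.inter (hVo n),
        inter_subset_right, ?_⟩
      refine (hup n _ ((hUo.inter (hVo n)).measurableSet.diff (hBm n))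
        (sdiff_subset.trans inter_subset_right)).trans ?_
      have : μ ((U ∩ V n) \ (A ∩ V n)) ≤ (ε n : ℝ≥0∞) / ((n : ℝ≥0) + 1 : ℝ≥0) :=
        (measure_mono (sdiff_subset_sdiff_left inter_subset_left)).trans hlt.le
      calc _ ≤ (((n : ℝ≥0) + 1 : ℝ≥0) : ℝ≥0∞) * ((ε n : ℝ≥0∞) / ((n : ℝ≥0) + 1 : ℝ≥0)) := by
            gcongr
        _ = ε n := ENNReal.mul_div_cancel (hpos' n) ENNReal.coe_ne_top
    choose U hU hUo hUV hUε using hex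
    refine ⟨⋃ n, U n, fun x hx => ?_, isOpen_iUnion hUo, ?_⟩
    · obtain ⟨n, hn⟩ := hVU x
      exact mem_iUnion.2 ⟨n, hU n ⟨hx, hn⟩⟩
    · have hsub : (⋃ n, U n) ⊆ A ∪ ⋃ n, (U n \ (A ∩ V n)) := by
        intro x hx
        obtain ⟨n, hn⟩ := mem_iUnion.1 hx
        by_cases hxA : x ∈ A
        · exact Or.inl hxA
        · exact Or.inr (mem_iUnion.2 ⟨n, hn, fun h => hxA h.1⟩)
      calc ν (⋃ n, U n) ≤ ν A + ν (⋃ n, (U n \ (A ∩ V n))) :=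
            (measure_mono hsub).trans (measure_union_le _ _)
        _ ≤ ν A + ∑' n, (ε n : ℝ≥0∞) := by
            gcongr
            exact (measure_iUnion_le _).trans (ENNReal.tsum_le_tsum hUε)
        _ < ν A + (r - ν A) := by
            exact ENNReal.add_lt_add_left (hr.ne_top) hsum
        _ = r := add_tsub_cancel_of_le hr.le
  · intro O hO r hr
    have hsup : ν O = ⨆ n, ν (O ∩ V n) := by
      rw [← Monotone.measure_iUnion (fun m n h => inter_subset_inter_right O (hVmono h)),
        ← inter_iUnion, iUnion_eq_univ_iff.2 hVU, inter_univ]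
    rw [hsup] at hr
    obtain ⟨n, hn⟩ := lt_iSup_iff.1 hr
    have hOn : IsOpen (O ∩ V n) := hO.inter (hVo n)
    by_cases htop : μ (O ∩ V n) = ∞
    · have : r * ((n : ℝ≥0) + 1 : ℝ≥0) < μ (O ∩ V n) := by
        rw [htop]
        exact ENNReal.mul_lt_top (hn.trans_le le_top) ENNReal.coe_lt_top
      obtain ⟨K, hK, hKc, hlt⟩ := hOn.exists_lt_isCompact this
      refine ⟨K, hK.trans inter_subset_left, hKc, ?_⟩
      refine lt_of_lt_of_le ?_ (hlow n K hKc.measurableSet (hK.trans inter_subset_right))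
      rw [ENNReal.coe_inv (by positivity), mul_comm, ← div_eq_mul_inv,
        ENNReal.lt_div_iff_mul_lt (Or.inl (hpos' n)) (Or.inl ENNReal.coe_ne_top)]
      exact hlt
    · obtain ⟨K, hK, hKc, hlt⟩ := hOn.measurableSet.exists_isCompact_sdiff_lt htop
        (ε := (ν (O ∩ V n) - r) / ((n : ℝ≥0) + 1 : ℝ≥0))
        (ENNReal.div_pos (tsub_pos_of_lt hn).ne' ENNReal.coe_ne_top).ne'
      refine ⟨K, hK.trans inter_subset_left, hKc, ?_⟩
      have hdiff : ν ((O ∩ V n) \ K) < ν (O ∩ V n) - r := by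
        refine (hup n _ (hOn.measurableSet.diff hKc.measurableSet)
          (sdiff_subset.trans inter_subset_right)).trans_lt ?_
        rw [mul_comm, ← ENNReal.lt_div_iff_mul_lt (Or.inl (hpos' n)) (Or.inl ENNReal.coe_ne_top)]
        exact hlt
      by_contra! hle
      have : ν (O ∩ V n) ≤ ν K + ν ((O ∩ V n) \ K) := by
        rw [← measure_inter_add_sdiff (O ∩ V n) hKc.measurableSet]
        gcongr
        exact inter_subset_right
      have h2 : ν (O ∩ V n) < r + (ν (O ∩ V n) - r) :=
        this.trans_lt (ENNReal.add_lt_add_of_le_of_lt (ne_top_of_le_ne_top hn.ne_top hle) hle hdiff)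
      rw [add_tsub_cancel_of_le hn.le] at h2
      exact lt_irrefl _ h2

section modular
variable {G : Type*} [Group G] [TopologicalSpace G] [IsTopologicalGroup G] [LocallyCompactSpace G]
  [T2Space G] [MeasurableSpace G] [BorelSpace G]

theorem integral_mul_right_haar {g : G → ℝ} (hg : Continuous g) (hg' : HasCompactSupport g) (y : G) :
    ∫ z, g (z * y) ∂(haar : Measure G) = modularCharacter y * ∫ z, g z ∂(haar : Measure G) := by
  have h := integral_isMulLeftInvariant_eq_smul_of_hasCompactSupport
    (map (· * y) (haar : Measure G)) haar hg hg'
  rw [← modularCharacterFun_eq_haarScalarFactor,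
    integral_map (by fun_prop) hg.aestronglyMeasurable, integral_smul_nnreal_measure] at h
  rw [h, NNReal.smul_def]
  rfl

theorem continuous_modularCharacter : Continuous (modularCharacter : G → ℝ≥0) := by
  obtain ⟨⟨g, hg⟩, hg', g0, g1⟩ := exists_continuous_nonneg_pos (1 : G)
  have hI : 0 < ∫ z, g z ∂(haar : Measure G) :=
    hg.integral_pos_of_hasCompactSupport_nonneg_nonzero hg' g0 g1
  have h1 : Continuous fun y : G => ∫ z, g (z⁻¹ * y) ∂(haar : Measure G).inv :=
    continuous_integral_apply_inv_mul hg hg'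
  have h2 : ∀ y : G, ∫ z, g (z⁻¹ * y) ∂(haar : Measure G).inv
      = modularCharacter y * ∫ z, g z ∂(haar : Measure G) := by
    intro y
    rw [← integral_mul_right_haar hg hg', Measure.inv, integral_map (by fun_prop)
      (by exact (by fun_prop : Continuous fun z => g (z⁻¹ * y)).aestronglyMeasurable)]
    simp
  rw [NNReal.isEmbedding_coe.continuous_iff]
  have h3 : (NNReal.toReal ∘ (modularCharacter : G → ℝ≥0)) =
      fun y => (∫ z, g (z⁻¹ * y) ∂(haar : Measure G).inv) / ∫ z, g z ∂(haar : Measure G) := by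
    funext y
    rw [h2, mul_div_cancel_right₀ _ hI.ne']
    rfl
  rw [h3]
  exact h1.div_const _

theorem inv_haar_eq_withDensity :
    (haar : Measure G).inv =
      (haar : Measure G).withDensity fun x => (modularCharacter x : ℝ≥0∞) := by
  have hpos : ∀ x : G, 0 < modularCharacter x := modularCharacterFun_pos
  have := regular_withDensity (haar : Measure G) continuous_modularCharacter hpos
  refine Measure.ext_of_integral_eq_on_compactlySupported fun f => ?_
  obtain ⟨⟨g, hg⟩, hg', g0, g1⟩ := exists_continuous_nonneg_pos (1 : G)
  have hI : 0 < ∫ z, g z ∂(haar : Measure G) :=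
    hg.integral_pos_of_hasCompactSupport_nonneg_nonzero hg' g0 g1
  have hδ : Continuous fun x : G => (modularCharacter x : ℝ) :=
    NNReal.continuous_coe.comp continuous_modularCharacter
  have key := integral_isMulLeftInvariant_isMulRightInvariant_combo
    (μ := (haar : Measure G)) (ν := (haar : Measure G).inv)
    (f := fun x => f x * modularCharacter x) (f.continuous.mul hδ)
    (f.hasCompactSupport.mul_right) hg hg' g0 g1
  have h2 : ∀ y : G, ∫ z, g (z⁻¹ * y) ∂(haar : Measure G).inv
      = modularCharacter y * ∫ z, g z ∂(haar : Measure G) := by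
    intro y
    rw [← integral_mul_right_haar hg hg', Measure.inv, integral_map (by fun_prop)
      (by exact (by fun_prop : Continuous fun z => g (z⁻¹ * y)).aestronglyMeasurable)]
    simp
  rw [integral_withDensity_eq_integral_smul continuous_modularCharacter.measurable]
  simp only [NNReal.smul_def, smul_eq_mul]
  rw [show (fun x => (modularCharacter x : ℝ) * f x) = fun x => f x * modularCharacter x from
    funext fun x => mul_comm _ _, key, ← integral_mul_const]
  congr 1
  funext y
  rw [h2]
  have : (modularCharacter y : ℝ) ≠ 0 := by exact_mod_cast (hpos y).ne'
  field_simp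

end modular

theorem exists_cc_approx {X : Type*} [TopologicalSpace X] [LocallyCompactSpace X] [T2Space X]
    [MeasurableSpace X] [BorelSpace X] {μ : Measure X} [μ.Regular] {f : X → ℂ} (hf : MemLp f 1 μ)
    {ε : ℝ≥0∞} (hε : ε ≠ 0) :
    ∃ g : X → ℂ, eLpNorm (f - g) 1 μ ≤ ε ∧ Continuous g ∧ MemLp g 1 μ ∧ HasCompactSupport g := by
  apply hf.induction_dense ENNReal.one_ne_top _ _ _ _ hε
  rotate_left
  · rintro f g ⟨f_cont, f_mem, hf⟩ ⟨g_cont, g_mem, hg⟩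
    exact ⟨f_cont.add g_cont, f_mem.add g_mem, hf.add hg⟩
  · rintro f ⟨-, f_mem, -⟩
    exact f_mem.aestronglyMeasurable
  intro c t ht htμ ε hε
  obtain ⟨η, ηpos, hη⟩ :
      ∃ η : ℝ≥0, 0 < η ∧ ∀ s : Set X, μ s ≤ η → eLpNorm (s.indicator fun _x => c) 1 μ ≤ ε :=
    exists_eLpNorm_indicator_le ENNReal.one_ne_top c hε
  have hη2 : (η : ℝ≥0∞) / 2 ≠ 0 := (ENNReal.half_pos (by exact_mod_cast ηpos.ne')).ne'
  obtain ⟨s, st, s_compact, μs⟩ := ht.exists_isCompact_sdiff_lt htμ.ne hη2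
  obtain ⟨V, sV, V_open, -, hV⟩ :=
    s_compact.measurableSet.exists_isOpen_sdiff_lt (μ := μ) s_compact.measure_lt_top.ne hη2
  obtain ⟨g, gs, gV, g_supp, g01⟩ := exists_continuous_one_zero_of_isCompact s_compact
    V_open.isClosed_compl (disjoint_compl_right_iff_subset.2 sV)
  have g_cont : Continuous fun x => ((g x : ℝ) : ℂ) * c := by fun_prop
  have g_cs : HasCompactSupport fun x => ((g x : ℝ) : ℂ) * c :=
    (g_supp.comp_left (g := fun r : ℝ => (r : ℂ)) (by simp)).mul_right
  have g_mem : MemLp (fun x => ((g x : ℝ) : ℂ) * c) 1 μ :=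
    g_cont.memLp_of_hasCompactSupport g_cs
  refine ⟨fun x => (g x : ℂ) * c, ?_, g_cont, g_mem, g_cs⟩
  have hle : μ ((V \ s) ∪ (t \ s)) ≤ η :=
    (measure_union_le _ _).trans ((add_le_add hV.le μs.le).trans (ENNReal.add_halves _).le)
  refine (eLpNorm_mono fun x => ?_).trans (hη _ hle)
  by_cases hx : x ∈ s
  · simp [gs hx, st hx, hx]
  · by_cases hxV : x ∈ V
    · have hm : x ∈ (V \ s) ∪ (t \ s) := Or.inl ⟨hxV, hx⟩
      rw [indicator_of_mem hm, Pi.sub_apply]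
      have h0 := (g01 x).1
      have h1 := (g01 x).2
      by_cases hxt : x ∈ t
      · rw [indicator_of_mem hxt, show ((g x : ℝ) : ℂ) * c - c = (((g x : ℝ) - 1 : ℝ) : ℂ) * c by
          push_cast; ring, norm_mul, Complex.norm_real, Real.norm_eq_abs]
        refine mul_le_of_le_one_left (norm_nonneg _) ?_
        rw [abs_le]; constructor <;> linarith
      · rw [indicator_of_notMem hxt, sub_zero, norm_mul, Complex.norm_real, Real.norm_eq_abs]
        refine mul_le_of_le_one_left (norm_nonneg _) ?_
        rw [abs_le]; constructor <;> linarith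
    · by_cases hxt : x ∈ t
      · have hm : x ∈ (V \ s) ∪ (t \ s) := Or.inr ⟨hxt, hx⟩
        rw [indicator_of_mem hm]
        simp [gV hxV, hxt]
      · simp [gV hxV, hxt]

section convolution
variable {K G : Type*}
  [Group K] [TopologicalSpace K] [IsTopologicalGroup K] [LocallyCompactSpace K] [T2Space K]
  [MeasurableSpace K] [BorelSpace K]
  [Group G] [TopologicalSpace G] [IsTopologicalGroup G] [LocallyCompactSpace G] [T2Space G]
  [MeasurableSpace G] [BorelSpace G]
  [MulAction K G] [ContinuousSMul K G] [SMulInvariantMeasure K G (haar : Measure G)]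

/-- The left translate `x ↦ f (k⁻¹ • x)` of the class of an integrable function `f` on `G`. -/
def translate (k : K) (f : Lp ℂ 1 (haar : Measure G)) : Lp ℂ 1 (haar : Measure G) :=
  DomMulAct.mk k⁻¹ • f

/-- The convolution `(a ∗ f)(x) = ∫ a(k) f(k⁻¹ • x) dk` of `a ∈ L¹(K)` and `f ∈ L¹(G)`, where `K`
acts on `G`, as the `L¹(G)`-valued Bochner integral of `k ↦ a(k) • (f(k⁻¹ • ·))`. -/
def conv (a : Lp ℂ 1 (haar : Measure K)) (f : Lp ℂ 1 (haar : Measure G)) :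
    Lp ℂ 1 (haar : Measure G) :=
  ∫ k, a k • translate k f ∂(haar : Measure K)

theorem translate_add (k : K) (f g : Lp ℂ 1 (haar : Measure G)) :
    translate k (f + g) = translate k f + translate k g := DomMulAct.smul_Lp_add _ _ _

theorem translate_smul (k : K) (c : ℂ) (f : Lp ℂ 1 (haar : Measure G)) :
    translate k (c • f) = c • translate k f := smul_comm _ _ _

theorem norm_translate (k : K) (f : Lp ℂ 1 (haar : Measure G)) : ‖translate k f‖ = ‖f‖ :=
  DomMulAct.norm_smul_Lp _ _

theorem translate_mul (k l : K) (f : Lp ℂ 1 (haar : Measure G)) :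
    translate (k * l) f = translate k (translate l f) := by
  simp only [translate, smul_smul, mul_inv_rev, ← DomMulAct.mk_mul]

theorem continuous_translate (f : Lp ℂ 1 (haar : Measure G)) :
    Continuous fun k : K => translate k f := by
  have : Fact ((1 : ℝ≥0∞) ≠ ∞) := ⟨ENNReal.one_ne_top⟩
  have h : Continuous fun k : K => DomMulAct.mk k⁻¹ :=
    DomMulAct.continuous_mk.comp continuous_inv
  exact h.smul continuous_const

theorem translate_coeFn (k : K) (f : Lp ℂ 1 (haar : Measure G)) :
    translate k f =ᵐ[haar] fun x => f (k⁻¹ • x) := DomMulAct.smul_Lp_ae_eq _ _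

/-- Translation as a continuous linear map. -/
def translateL (k : K) : Lp ℂ 1 (haar : Measure G) →L[ℂ] Lp ℂ 1 (haar : Measure G) :=
  LinearMap.mkContinuous
    { toFun := translate k, map_add' := translate_add k, map_smul' := translate_smul k } 1
    fun f => by simp [norm_translate]

theorem dense_cc (f : Lp ℂ 1 (haar : Measure G)) {ε : ℝ} (hε : 0 < ε) :
    ∃ g : G → ℂ, ∃ hg : MemLp g 1 (haar : Measure G), Continuous g ∧ HasCompactSupport g ∧
      ‖f - hg.toLp g‖ ≤ ε := by
  obtain ⟨g, h2, h3, h4, h1⟩ := exists_cc_approx (Lp.memLp f) (ε := ENNReal.ofReal ε)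
    (by simpa using hε)
  refine ⟨g, h4, h3, h1, ?_⟩
  rw [Lp.norm_def]
  refine ENNReal.toReal_le_of_le_ofReal hε.le (le_trans (le_of_eq ?_) h2)
  refine eLpNorm_congr_ae ?_
  filter_upwards [Lp.coeFn_sub f (h4.toLp g), h4.coeFn_toLp] with x hx hx'
  rw [hx, Pi.sub_apply, Pi.sub_apply, hx']

theorem aestronglyMeasurable_conv {E : Type*} [NormedAddCommGroup E] [NormedSpace ℂ E]
    (a : Lp ℂ 1 (haar : Measure K)) {F : K → E} (hF : Continuous F) :
    AEStronglyMeasurable (fun k => a k • F k) (haar : Measure K) := by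
  have hpos : ∀ n : ℕ, (0 : ℝ) < 1 / ((n : ℝ) + 1) := fun n => by positivity
  choose g hg hgc hgs hgn using fun n : ℕ => dense_cc a (hpos n)
  have ht : Tendsto (fun n => (hg n).toLp (g n)) atTop (𝓝 a) := by
    rw [tendsto_iff_norm_sub_tendsto_zero]
    refine squeeze_zero (fun _ => norm_nonneg _) (fun n => ?_) tendsto_one_div_add_atTop_nhds_zero_nat
    rw [norm_sub_rev]
    exact hgn n
  obtain ⟨ns, -, hns⟩ := (tendstoInMeasure_of_tendsto_Lp ht).exists_seq_tendsto_ae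
  refine aestronglyMeasurable_of_tendsto_ae atTop (f := fun i k => g (ns i) k • F k) (fun i => ?_) ?_
  · exact (((hgc _).smul hF).stronglyMeasurable_of_hasCompactSupport
      ((hgs _).smul_right)).aestronglyMeasurable
  · have hall : ∀ᵐ k ∂(haar : Measure K), ∀ n, (hg n).toLp (g n) k = g n k :=
      ae_all_iff.2 fun n => (hg n).coeFn_toLp
    filter_upwards [hns, hall] with k hk hk'
    simp only [hk'] at hk
    exact hk.smul_const _

theorem integrable_conv (a : Lp ℂ 1 (haar : Measure K)) (f : Lp ℂ 1 (haar : Measure G)) :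
    Integrable (fun k => a k • translate k f) (haar : Measure K) := by
  refine ((L1.integrable_coeFn a).norm.mul_const ‖f‖).mono'
    (aestronglyMeasurable_conv a (continuous_translate f)) (ae_of_all _ fun k => ?_)
  rw [norm_smul, norm_translate]

theorem norm_conv_le (a : Lp ℂ 1 (haar : Measure K)) (f : Lp ℂ 1 (haar : Measure G)) :
    ‖conv a f‖ ≤ ‖a‖ * ‖f‖ := by
  refine (norm_integral_le_integral_norm _).trans (le_of_eq ?_)
  simp only [norm_smul, norm_translate]
  rw [integral_mul_const, ← L1.norm_eq_integral_norm]

theorem conv_add (a : Lp ℂ 1 (haar : Measure K)) (f g : Lp ℂ 1 (haar : Measure G)) :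
    conv a (f + g) = conv a f + conv a g := by
  simp only [conv, translate_add, smul_add]
  exact integral_add (integrable_conv a f) (integrable_conv a g)

theorem conv_smul (a : Lp ℂ 1 (haar : Measure K)) (c : ℂ) (f : Lp ℂ 1 (haar : Measure G)) :
    conv a (c • f) = c • conv a f := by
  simp only [conv, translate_smul]
  rw [← integral_smul]
  exact integral_congr_ae (ae_of_all _ fun k => smul_comm _ _ _)

theorem add_conv (a b : Lp ℂ 1 (haar : Measure K)) (f : Lp ℂ 1 (haar : Measure G)) :
    conv (a + b) f = conv a f + conv b f := by
  rw [conv, conv, conv, ← integral_add (integrable_conv a f) (integrable_conv b f)]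
  refine integral_congr_ae ?_
  filter_upwards [Lp.coeFn_add a b] with k hk
  rw [hk, Pi.add_apply, add_smul]

theorem smul_conv (c : ℂ) (a : Lp ℂ 1 (haar : Measure K)) (f : Lp ℂ 1 (haar : Measure G)) :
    conv (c • a) f = c • conv a f := by
  rw [conv, conv, ← integral_smul]
  refine integral_congr_ae ?_
  filter_upwards [Lp.coeFn_smul c a] with k hk
  rw [hk, Pi.smul_apply, smul_assoc]

/-- Convolution as a continuous bilinear map. -/
def convL : Lp ℂ 1 (haar : Measure K) →L[ℂ] Lp ℂ 1 (haar : Measure G) →L[ℂ]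
    Lp ℂ 1 (haar : Measure G) :=
  LinearMap.mkContinuous₂ (LinearMap.mk₂ ℂ conv add_conv smul_conv conv_add fun c a f => conv_smul a c f) 1
    fun a f => by simpa using norm_conv_le a f

theorem convL_apply (a : Lp ℂ 1 (haar : Measure K)) (f : Lp ℂ 1 (haar : Measure G)) :
    convL a f = conv a f := rfl

theorem conv_translate (k : K) (b : Lp ℂ 1 (haar : Measure K)) (f : Lp ℂ 1 (haar : Measure G)) :
    conv (translate k b) f = translate k (conv b f) := by
  have h1 : translate k (conv b f) = ∫ l, b l • translate (k * l) f ∂(haar : Measure K) := by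
    rw [conv]
    have := (translateL (G := G) k).integral_comp_comm (integrable_conv b f)
    change _ = translate k _ at this
    rw [← this]
    refine integral_congr_ae (ae_of_all _ fun l => ?_)
    change translate k (b l • translate l f) = _
    rw [translate_smul, ← translate_mul]
  rw [h1, conv, ← integral_mul_left_eq_self (fun l => b l • translate (k * l) f) k⁻¹]
  refine integral_congr_ae ?_
  filter_upwards [translate_coeFn k b] with l hl
  rw [hl, smul_eq_mul, mul_inv_cancel_left]

theorem conv_assoc (a b : Lp ℂ 1 (haar : Measure K)) (f : Lp ℂ 1 (haar : Measure G)) :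
    conv (conv a b) f = conv a (conv b f) := by
  have := ((convL (K := K) (G := G)).flip f).integral_comp_comm (integrable_conv a b)
  change _ = conv (conv a b) f at this
  rw [← this, conv]
  refine integral_congr_ae (ae_of_all _ fun k => ?_)
  change conv (a k • translate k b) f = _
  rw [smul_conv, conv_translate]

theorem continuous_conv : Continuous fun p : Lp ℂ 1 (haar : Measure K) × Lp ℂ 1 (haar : Measure G) =>
    conv p.1 p.2 := (convL (K := K) (G := G)).continuous₂

/-- On continuous functions with compact support, `conv` is given by the usual integral. -/
theorem conv_coeFn {f : K → ℂ} {g : G → ℂ} (hf : MemLp f 1 (haar : Measure K))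
    (hg : MemLp g 1 (haar : Measure G)) (fc : Continuous f) (fs : HasCompactSupport f)
    (gc : Continuous g) (gs : HasCompactSupport g) :
    conv (hf.toLp f) (hg.toLp g) =ᵐ[haar] fun x => ∫ k, f k * g (k⁻¹ • x) ∂(haar : Measure K) := by
  let S : Set G := (fun p : K × G => p.1 • p.2) '' (tsupport f ×ˢ tsupport g)
  have hS : IsCompact S := (fs.prod gs).image (by fun_prop)
  have hzero : ∀ k x, f k * g (k⁻¹ • x) ≠ 0 → k ∈ tsupport f ∧ x ∈ S := by
    intro k x h
    have h1 := subset_tsupport f (left_ne_zero_of_mul h)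
    have h2 := subset_tsupport g (right_ne_zero_of_mul h)
    exact ⟨h1, ⟨(k, k⁻¹ • x), ⟨h1, h2⟩, by simp⟩⟩
  have hFc : Continuous (Function.uncurry fun (k : K) (x : G) => f k * g (k⁻¹ • x)) := by
    unfold Function.uncurry
    fun_prop
  have hFs : HasCompactSupport (Function.uncurry fun (k : K) (x : G) => f k * g (k⁻¹ • x)) := by
    refine HasCompactSupport.intro (IsCompact.prod fs hS) fun p hp => ?_
    by_contra h
    exact hp (hzero p.1 p.2 h)
  have hhc : Continuous fun x => ∫ k, f k * g (k⁻¹ • x) ∂(haar : Measure K) := by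
    rw [← continuousOn_univ]
    refine continuousOn_integral_of_compact_support (k := tsupport f) fs ?_ ?_
    · exact (hFc.comp continuous_swap).continuousOn
    · intro x k _ hk
      simp [image_eq_zero_of_notMem_tsupport hk]
  have hhs : HasCompactSupport fun x => ∫ k, f k * g (k⁻¹ • x) ∂(haar : Measure K) := by
    refine HasCompactSupport.intro hS fun x hx => ?_
    refine integral_eq_zero_of_ae (ae_of_all _ fun k => ?_)
    by_contra h
    exact hx (hzero k x h).2
  refine Integrable.ae_eq_of_forall_setIntegral_eq _ _ (L1.integrable_coeFn _)
    (hhc.integrable_of_hasCompactSupport hhs) fun s hs _ => ?_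
  let φ : Lp ℂ 1 (haar : Measure G) →L[ℂ] ℂ := LinearMap.mkContinuous
    { toFun := fun u => ∫ x in s, u x ∂(haar : Measure G)
      map_add' := fun u v => by
        rw [← integral_add (L1.integrable_coeFn u).integrableOn (L1.integrable_coeFn v).integrableOn]
        exact integral_congr_ae (ae_restrict_of_ae (Lp.coeFn_add u v))
      map_smul' := fun c u => by
        rw [← integral_smul]
        exact integral_congr_ae (ae_restrict_of_ae (Lp.coeFn_smul c u)) } 1 fun u => by
      rw [one_mul, L1.norm_eq_integral_norm]
      exact (norm_integral_le_integral_norm _).trans (setIntegral_le_integral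
        (L1.integrable_coeFn u).norm (ae_of_all _ fun _ => norm_nonneg _))
  have h1 := φ.integral_comp_comm (integrable_conv (hf.toLp f) (hg.toLp g))
  have h2 : φ (∫ k, (hf.toLp f) k • translate k (hg.toLp g) ∂(haar : Measure K))
    = ∫ x in s, conv (hf.toLp f) (hg.toLp g) x ∂(haar : Measure G) := rfl
  rw [← h2, ← h1, ← integral_integral_swap_of_hasCompactSupport hFc hFs]
  refine integral_congr_ae ?_
  filter_upwards [hf.coeFn_toLp] with k hk
  rw [map_smul, hk, smul_eq_mul, integral_const_mul]
  congr 1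
  refine integral_congr_ae (ae_restrict_of_ae ?_)
  have h3 := (measurePreserving_smul k⁻¹ (haar : Measure G)).quasiMeasurePreserving.ae_eq_comp
    hg.coeFn_toLp
  exact (translate_coeFn k (hg.toLp g)).trans h3

end convolution

section involution
variable {G : Type*} [Group G] [TopologicalSpace G] [IsTopologicalGroup G] [LocallyCompactSpace G]
  [T2Space G] [MeasurableSpace G] [BorelSpace G]

/-- The involution `f⋆(x) = Δ(x⁻¹) conj (f (x⁻¹))` on functions. Mathlib's `modularCharacter x` is
`μ(· x⁻¹) / μ`, that is `Δ(x⁻¹)` in the convention `μ(A x) = Δ(x) μ(A)` for the left Haar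
measure `μ`. -/
def involFun (f : G → ℂ) (x : G) : ℂ := (modularCharacter x : ℝ) * conj (f x⁻¹)

theorem quasiMeasurePreserving_inv_haar :
    QuasiMeasurePreserving (fun x : G => x⁻¹) haar haar := by
  refine ⟨measurable_inv, ?_⟩
  have : map (fun x : G => x⁻¹) haar = (haar : Measure G).inv := rfl
  rw [this, inv_haar_eq_withDensity]
  exact withDensity_absolutelyContinuous _ _

theorem aestronglyMeasurable_involFun {f : G → ℂ}
    (hf : AEStronglyMeasurable f (haar : Measure G)) :
    AEStronglyMeasurable (involFun f) (haar : Measure G) := by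
  have h1 : AEStronglyMeasurable (fun x : G => f x⁻¹) (haar : Measure G) :=
    hf.comp_quasiMeasurePreserving quasiMeasurePreserving_inv_haar
  have h2 : Measurable fun x : G => (((modularCharacter x : ℝ≥0) : ℝ) : ℂ) := by
    have := (continuous_modularCharacter (G := G)).measurable
    fun_prop
  exact h2.aestronglyMeasurable.mul (Complex.continuous_conj.comp_aestronglyMeasurable h1)

theorem eLpNorm_involFun {f : G → ℂ} (hf : AEStronglyMeasurable f (haar : Measure G)) :
    eLpNorm (involFun f) 1 (haar : Measure G) = eLpNorm f 1 (haar : Measure G) := by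
  have h1 : AEStronglyMeasurable (fun x : G => f x⁻¹) (haar : Measure G) :=
    hf.comp_quasiMeasurePreserving quasiMeasurePreserving_inv_haar
  have hδ := (continuous_modularCharacter (G := G)).measurable
  rw [eLpNorm_one_eq_lintegral_enorm, eLpNorm_one_eq_lintegral_enorm]
  calc ∫⁻ x, ‖involFun f x‖ₑ ∂(haar : Measure G)
      = ∫⁻ x, ((fun x : G => ((modularCharacter x : ℝ≥0) : ℝ≥0∞)) * (fun x : G => ‖f x⁻¹‖ₑ) : G → ℝ≥0∞) x
          ∂(haar : Measure G) := by
        refine lintegral_congr fun x => ?_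
        simp only [involFun, Pi.mul_apply, enorm_mul, RCLike.enorm_conj]
        congr 1
        rw [← ofReal_norm, Complex.norm_real, Real.norm_of_nonneg (NNReal.coe_nonneg _),
          ENNReal.ofReal_coe_nnreal]
    _ = ∫⁻ x, ‖f x⁻¹‖ₑ ∂(haar : Measure G).inv := by
        rw [inv_haar_eq_withDensity,
          lintegral_withDensity_eq_lintegral_mul₀ (by fun_prop) h1.enorm]
    _ = ∫⁻ x, ‖f x‖ₑ ∂(haar : Measure G) := by
        have e := lintegral_map_equiv (μ := (haar : Measure G)) (fun x => ‖f x⁻¹‖ₑ)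
          (MeasurableEquiv.inv G)
        simpa [Measure.inv] using e

theorem memLp_involFun {f : G → ℂ} (hf : MemLp f 1 (haar : Measure G)) :
    MemLp (involFun f) 1 (haar : Measure G) :=
  ⟨aestronglyMeasurable_involFun hf.1, by rw [eLpNorm_involFun hf.1]; exact hf.2⟩

theorem involFun_congr {f g : G → ℂ} (h : f =ᵐ[haar] g) : involFun f =ᵐ[haar] involFun g := by
  filter_upwards [quasiMeasurePreserving_inv_haar.ae_eq_comp h] with x hx
  simp only [Function.comp_apply] at hx
  simp only [involFun, hx]

/-- The involution on `L¹(G)`. -/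
def invol (f : Lp ℂ 1 (haar : Measure G)) : Lp ℂ 1 (haar : Measure G) :=
  (memLp_involFun (Lp.memLp f)).toLp _

theorem invol_coeFn (f : Lp ℂ 1 (haar : Measure G)) : invol f =ᵐ[haar] involFun f :=
  (memLp_involFun (Lp.memLp f)).coeFn_toLp

theorem invol_toLp {f : G → ℂ} (hf : MemLp f 1 (haar : Measure G)) :
    invol (hf.toLp f) = (memLp_involFun hf).toLp _ :=
  MemLp.toLp_congr _ _ (involFun_congr hf.coeFn_toLp)

theorem norm_invol (f : Lp ℂ 1 (haar : Measure G)) : ‖invol f‖ = ‖f‖ := by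
  rw [invol, Lp.norm_toLp, eLpNorm_involFun (Lp.aestronglyMeasurable f), Lp.norm_def]

theorem invol_add (f g : Lp ℂ 1 (haar : Measure G)) : invol (f + g) = invol f + invol g := by
  refine Lp.ext ?_
  filter_upwards [invol_coeFn (f + g), invol_coeFn f, invol_coeFn g,
    Lp.coeFn_add (invol f) (invol g), involFun_congr (Lp.coeFn_add f g)] with x h1 h2 h3 h4 h5
  rw [h1, h4, h5, Pi.add_apply, h2, h3]
  simp [involFun, mul_add]

theorem invol_smul (c : ℂ) (f : Lp ℂ 1 (haar : Measure G)) :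
    invol (c • f) = conj c • invol f := by
  refine Lp.ext ?_
  filter_upwards [invol_coeFn (c • f), invol_coeFn f,
    Lp.coeFn_smul (conj c) (invol f), involFun_congr (Lp.coeFn_smul c f)] with x h1 h2 h4 h5
  rw [h1, h4, h5, Pi.smul_apply, h2]
  simp only [involFun, Pi.smul_apply, smul_eq_mul, map_mul]
  ring

theorem involFun_involFun (f : G → ℂ) : involFun (involFun f) = f := by
  funext x
  have h : ((modularCharacter x : ℝ≥0) : ℝ) * ((modularCharacter x⁻¹ : ℝ≥0) : ℝ) = 1 := by
    rw [← NNReal.coe_mul, ← map_mul, mul_inv_cancel, map_one, NNReal.coe_one]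
  simp only [involFun, map_mul, Complex.conj_ofReal, inv_inv, Complex.conj_conj]
  rw [← mul_assoc, ← Complex.ofReal_mul, h]
  simp

theorem invol_invol (f : Lp ℂ 1 (haar : Measure G)) : invol (invol f) = f := by
  refine Lp.ext ?_
  filter_upwards [invol_coeFn (invol f), involFun_congr (invol_coeFn f)] with x h1 h2
  rw [h1, h2, involFun_involFun]

theorem continuous_invol : Continuous (invol (G := G)) := by
  let e : Lp ℂ 1 (haar : Measure G) →+ Lp ℂ 1 (haar : Measure G) :=
    AddMonoidHom.mk' invol invol_add
  exact (AddMonoidHomClass.isometry_of_norm e norm_invol).continuous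

theorem continuous_involFun {f : G → ℂ} (hf : Continuous f) : Continuous (involFun f) := by
  have := continuous_modularCharacter (G := G)
  unfold involFun
  fun_prop

theorem hasCompactSupport_involFun {f : G → ℂ} (hf : HasCompactSupport f) :
    HasCompactSupport (involFun f) := by
  have h1 : HasCompactSupport fun x : G => f x⁻¹ := hf.comp_homeomorph (Homeomorph.inv G)
  exact (h1.comp_left (g := fun z : ℂ => conj z) (by simp)).mul_left

theorem invol_conv_cc {f g : G → ℂ} (hf : MemLp f 1 (haar : Measure G))
    (hg : MemLp g 1 (haar : Measure G)) (fc : Continuous f) (fs : HasCompactSupport f)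
    (gc : Continuous g) (gs : HasCompactSupport g) :
    invol (conv (hf.toLp f) (hg.toLp g)) = conv (invol (hg.toLp g)) (invol (hf.toLp f)) := by
  rw [invol_toLp hf, invol_toLp hg]
  refine Lp.ext ?_
  filter_upwards [invol_coeFn (conv (hf.toLp f) (hg.toLp g)),
    involFun_congr (conv_coeFn hf hg fc fs gc gs),
    conv_coeFn (memLp_involFun hg) (memLp_involFun hf) (continuous_involFun gc)
      (hasCompactSupport_involFun gs) (continuous_involFun fc) (hasCompactSupport_involFun fs)]
    with x h1 h2 h3
  rw [h1, h2, h3, ← integral_mul_left_eq_self _ x]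
  simp only [involFun]
  rw [← integral_conj, ← integral_const_mul]
  refine integral_congr_ae (ae_of_all _ fun y => ?_)
  have e1 : (x * y)⁻¹ = y⁻¹ • x⁻¹ := by simp
  have e2 : ((x * y)⁻¹ • x)⁻¹ = y := by simp
  have h : ((modularCharacter x : ℝ≥0) : ℝ) =
      ((modularCharacter (x * y) : ℝ≥0) : ℝ) * ((modularCharacter ((x * y)⁻¹ • x) : ℝ≥0) : ℝ) := by
    rw [← NNReal.coe_mul, ← map_mul]
    simp
  beta_reduce
  rw [e2, h, e1]
  push_cast
  rw [map_mul (starRingEnd ℂ)]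
  ring

theorem invol_conv (f g : Lp ℂ 1 (haar : Measure G)) :
    invol (conv f g) = conv (invol g) (invol f) := by
  let D : Set (Lp ℂ 1 (haar : Measure G)) := {u | ∃ g : G → ℂ, ∃ hg : MemLp g 1 (haar : Measure G),
    Continuous g ∧ HasCompactSupport g ∧ u = hg.toLp g}
  have hD : Dense D := by
    intro u
    rw [Metric.mem_closure_iff]
    intro ε hε
    obtain ⟨g, hg, gc, gs, h⟩ := dense_cc u (half_pos hε)
    refine ⟨_, ⟨g, hg, gc, gs, rfl⟩, ?_⟩
    rw [dist_eq_norm]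
    linarith
  refine hD.denseRange_val.induction_on₂ (p := fun f g => invol (conv f g) = conv (invol g) (invol f))
    ?_ ?_ f g
  · refine isClosed_eq ?_ ?_
    · exact continuous_invol.comp continuous_conv
    · exact continuous_conv.comp ((continuous_invol.comp continuous_snd).prodMk
        (continuous_invol.comp continuous_fst))
  · rintro ⟨_, f, hf, fc, fs, rfl⟩ ⟨_, g, hg, gc, gs, rfl⟩
    exact invol_conv_cc hf hg fc fs gc gs

end involution

section L1
variable (G : Type u) [Group G] [TopologicalSpace G] [IsTopologicalGroup G] [LocallyCompactSpace G]
  [MeasurableSpace G] [BorelSpace G]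

/-- The space `L¹(G)` with respect to left Haar measure. -/
def L1 : Type u := Lp ℂ 1 (haar : Measure G)

instance : NormedAddCommGroup (L1 G) := inferInstanceAs (NormedAddCommGroup (Lp ℂ 1 haar))
instance : NormedSpace ℂ (L1 G) := inferInstanceAs (NormedSpace ℂ (Lp ℂ 1 haar))
instance : CompleteSpace (L1 G) := inferInstanceAs (CompleteSpace (Lp ℂ 1 haar))

variable [T2Space G]

/-- `L¹(G)` with convolution as product. -/
instance : NonUnitalNormedRing (L1 G) where
  mul := fun f g => conv (K := G) (G := G) f g
  left_distrib := fun f g h => conv_add (K := G) (G := G) f g h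
  right_distrib := fun f g h => add_conv (K := G) (G := G) f g h
  zero_mul := fun f => by
    have h := add_conv (K := G) (G := G) (0 : Lp ℂ 1 haar) 0 f
    rw [add_zero] at h
    exact left_eq_add.1 h
  mul_zero := fun f => by
    have h := conv_add (K := G) (G := G) f (0 : Lp ℂ 1 haar) 0
    rw [add_zero] at h
    exact left_eq_add.1 h
  mul_assoc := fun f g h => conv_assoc (K := G) (G := G) f g h
  dist_eq := NormedAddCommGroup.dist_eq
  norm_mul_le := fun f g => norm_conv_le (K := G) (G := G) f g

instance : IsScalarTower ℂ (L1 G) (L1 G) := ⟨fun c f g => smul_conv (K := G) (G := G) c f g⟩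
instance : SMulCommClass ℂ (L1 G) (L1 G) := ⟨fun c f g => (conv_smul (K := G) (G := G) f c g).symm⟩

/-- The involution of `L¹(G)`. -/
instance : StarRing (L1 G) where
  star := fun f => invol f
  star_involutive := fun f => invol_invol f
  star_mul := fun f g => invol_conv f g
  star_add := fun f g => invol_add f g

instance : NormedStarGroup (L1 G) := ⟨fun f => (norm_invol f).le⟩
instance : StarModule ℂ (L1 G) := ⟨fun c f => invol_smul c f⟩

end L1

section envelope

/-- A `*`-representation of the `*`-algebra `A` by bounded operators on a Hilbert space. (Every
cyclic representation of `A` has an equivalent copy in the universe of `A`.) -/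
structure HilbertRep (A : Type u) [NonUnitalNormedRing A] [NormedSpace ℂ A] [StarRing A] :
    Type (u + 1) where
  /-- the Hilbert space -/
  carrier : Type u
  [normed : NormedAddCommGroup carrier]
  [inner : InnerProductSpace ℂ carrier]
  [complete : CompleteSpace carrier]
  /-- the representation -/
  rep : A →⋆ₙₐ[ℂ] (carrier →L[ℂ] carrier)

attribute [instance] HilbertRep.normed HilbertRep.inner HilbertRep.complete

variable (A : Type u) [NonUnitalNormedRing A] [NormedSpace ℂ A] [IsScalarTower ℂ A A]
  [SMulCommClass ℂ A A] [StarRing A] [NormedStarGroup A] [StarModule ℂ A] [CompleteSpace A]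

variable {A} in
theorem HilbertRep.norm_le (r : HilbertRep A) (a : A) : ‖r.rep a‖ ≤ ‖a‖ := by
  rcases subsingleton_or_nontrivial r.carrier with hs | hn
  · rw [Subsingleton.elim (r.rep a) 0, norm_zero]
    exact norm_nonneg _
  have hsa : ∀ b : A, IsSelfAdjoint b → ‖r.rep b‖ ≤ ‖b‖ := by
    intro b hb
    have hb' : IsSelfAdjoint (r.rep b) := hb.map r.rep
    have h1 := hb'.spectralRadius_eq_nnnorm
    have h2 : spectralRadius ℂ (r.rep b) ≤ ‖b‖₊ := by
      refine iSup₂_le fun k hk => ?_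
      let Φ : WithLp 1 (Unitization ℂ A) →ₐ[ℂ] (r.carrier →L[ℂ] r.carrier) :=
        (Unitization.lift (r.rep : A →ₙₐ[ℂ] (r.carrier →L[ℂ] r.carrier))).comp
          (WithLp.unitizationAlgEquiv (𝕜 := ℂ) (A := A) ℂ).toAlgHom
      have hΦ : Φ (WithLp.toLp 1 (b : Unitization ℂ A)) = r.rep b := by
        simp [Φ]
        rfl
      rw [← hΦ] at hk
      have h3 := AlgHom.spectrum_apply_subset Φ _ hk
      have h4 := spectrum.norm_le_norm_mul_of_mem h3
      have h5 : ‖(1 : WithLp 1 (Unitization ℂ A))‖ = 1 := by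
        rw [WithLp.unitization_norm_def]
        change ‖(1 : Unitization ℂ A).fst‖ + ‖(1 : Unitization ℂ A).snd‖ = 1
        simp
      rw [h5, mul_one, WithLp.unitization_norm_inr] at h4
      exact_mod_cast h4
    rw [h1] at h2
    exact_mod_cast h2
  have h1 : ‖r.rep a‖ * ‖r.rep a‖ ≤ ‖a‖ * ‖a‖ := by
    rw [← CStarRing.norm_star_mul_self, ← map_star, ← map_mul]
    refine (hsa _ (IsSelfAdjoint.star_mul_self a)).trans ((norm_mul_le _ _).trans ?_)
    rw [norm_star]
  exact abs_le_of_sq_le_sq' (by nlinarith) (norm_nonneg _) |>.2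

variable {A} in
/-- The enveloping `C*`-seminorm: the supremum of `‖π(a)‖` over all `*`-representations `π` of `A`
on Hilbert spaces. -/
def envNorm (a : A) : ℝ := ⨆ r : HilbertRep A, ‖r.rep a‖

variable {A} in
theorem HilbertRep.le_envNorm (r : HilbertRep A) (a : A) : ‖r.rep a‖ ≤ envNorm a :=
  le_ciSup (f := fun r : HilbertRep A => ‖r.rep a‖)
    ⟨‖a‖, by rintro _ ⟨r, rfl⟩; exact r.norm_le a⟩ r

variable {A} in
theorem envNorm_nonneg (a : A) : 0 ≤ envNorm a := Real.iSup_nonneg fun _ => norm_nonneg _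

variable {A} in
theorem envNorm_le (a : A) : envNorm a ≤ ‖a‖ := Real.iSup_le (fun r => r.norm_le a) (norm_nonneg _)

/-- A copy of `A`, to be equipped with the enveloping `C*`-seminorm. -/
def PreEnvelope : Type u := A

instance : NonUnitalRing (PreEnvelope A) := inferInstanceAs (NonUnitalRing A)
instance : Module ℂ (PreEnvelope A) := inferInstanceAs (Module ℂ A)
instance : IsScalarTower ℂ (PreEnvelope A) (PreEnvelope A) := inferInstanceAs (IsScalarTower ℂ A A)
instance : SMulCommClass ℂ (PreEnvelope A) (PreEnvelope A) := inferInstanceAs (SMulCommClass ℂ A A)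
instance : StarRing (PreEnvelope A) := inferInstanceAs (StarRing A)
instance : StarModule ℂ (PreEnvelope A) := inferInstanceAs (StarModule ℂ A)

/-- The enveloping `C*`-seminorm as a seminorm. -/
def envSeminorm : AddGroupSeminorm (PreEnvelope A) where
  toFun := fun a => envNorm (A := A) a
  map_zero' := le_antisymm ((envNorm_le (A := A) 0).trans norm_zero.le) (envNorm_nonneg _)
  add_le' := fun a b => Real.iSup_le (fun r => by
    have := map_add r.rep a b
    exact (congrArg norm this).le.trans
      ((norm_add_le _ _).trans (add_le_add (r.le_envNorm a) (r.le_envNorm b))))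
    (add_nonneg (envNorm_nonneg _) (envNorm_nonneg _))
  neg' := fun a => by
    refine congrArg iSup (funext fun r => ?_)
    have := map_neg r.rep a
    exact (congrArg norm this).trans (norm_neg _)

instance : SeminormedAddCommGroup (PreEnvelope A) :=
  (envSeminorm A).toSeminormedAddCommGroup

instance : NonUnitalSeminormedRing (PreEnvelope A) where
  dist_eq := SeminormedAddCommGroup.dist_eq
  norm_mul_le := fun a b => Real.iSup_le (fun r => by
    have := map_mul r.rep a b
    exact (congrArg norm this).le.trans
      ((norm_mul_le _ _).trans (mul_le_mul (r.le_envNorm a) (r.le_envNorm b) (norm_nonneg _)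
        (envNorm_nonneg _))))
    (mul_nonneg (envNorm_nonneg _) (envNorm_nonneg _))

instance : NormedSpace ℂ (PreEnvelope A) where
  norm_smul_le := fun c a => Real.iSup_le (fun r => by
    have := map_smul r.rep c a
    exact (congrArg norm this).le.trans
      ((norm_smul_le _ _).trans (mul_le_mul_of_nonneg_left (r.le_envNorm a) (norm_nonneg _))))
    (mul_nonneg (norm_nonneg _) (envNorm_nonneg _))

instance : NormedStarGroup (PreEnvelope A) where
  norm_star_le := fun a => Real.iSup_le (fun r => by
    have := map_star r.rep a
    exact (congrArg norm this).le.trans ((norm_star _).le.trans (r.le_envNorm a)))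
    (envNorm_nonneg _)

theorem envelope_norm_mul_self_le (a : PreEnvelope A) : ‖a‖ * ‖a‖ ≤ ‖star a * a‖ := by
  have h : ‖a‖ ≤ √‖star a * a‖ := by
    refine Real.iSup_le (fun r => Real.le_sqrt_of_sq_le ?_) (Real.sqrt_nonneg _)
    have h1 : r.rep (star (show A from a) * (show A from a))
        = star (r.rep (show A from a)) * r.rep (show A from a) := by
      rw [map_mul, map_star]
    rw [sq, ← CStarRing.norm_star_mul_self, ← h1]
    exact r.le_envNorm (star (show A from a) * (show A from a))
  calc ‖a‖ * ‖a‖ ≤ √‖star a * a‖ * √‖star a * a‖ :=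
        mul_le_mul h h (norm_nonneg _) (Real.sqrt_nonneg _)
    _ = ‖star a * a‖ := Real.mul_self_sqrt (norm_nonneg _)

open UniformSpace

/-- The enveloping `C*`-algebra `C*(A)` of the Banach `*`-algebra `A`: the (Hausdorff) completion of
`A` with respect to the enveloping `C*`-seminorm. -/
def CStar : Type u := Completion (PreEnvelope A)

namespace CStar

instance : NormedAddCommGroup (CStar A) := inferInstanceAs (NormedAddCommGroup (Completion _))
instance : NormedSpace ℂ (CStar A) := inferInstanceAs (NormedSpace ℂ (Completion _))
instance : CompleteSpace (CStar A) := inferInstanceAs (CompleteSpace (Completion _))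

variable {A} in
/-- The natural map `A → C*(A)`. -/
def of (a : A) : CStar A := ((show PreEnvelope A from a : PreEnvelope A) : Completion (PreEnvelope A))

variable {A} in
theorem isDenseInducing_of : IsDenseInducing fun a : PreEnvelope A => (of a : CStar A) :=
  Completion.isDenseInducing_coe

/-- The multiplication of `C*(A)`, extended by continuity from `A`. -/
instance : Mul (CStar A) :=
  ⟨fun x y => ((isDenseInducing_of (A := A)).prodMap (isDenseInducing_of (A := A))).extend
    (fun p => of ((show A from p.1) * (show A from p.2))) (x, y)⟩

theorem continuous_mul : Continuous fun p : CStar A × CStar A => p.1 * p.2 := by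
  let m : PreEnvelope A →+ PreEnvelope A →+ CStar A :=
    (AddMonoidHom.mul : PreEnvelope A →+ PreEnvelope A →+ PreEnvelope A).compr₂ Completion.toCompl
  have h : Continuous fun p : PreEnvelope A × PreEnvelope A => m p.1 p.2 :=
    (Completion.continuous_coe _).comp _root_.continuous_mul
  have di : IsDenseInducing (Completion.toCompl : PreEnvelope A → Completion (PreEnvelope A)) :=
    Completion.isDenseInducing_coe
  exact (di.extend_Z_bilin di h :)

instance : ContinuousMul (CStar A) := ⟨continuous_mul A⟩

variable {A} in
theorem of_mul (a b : A) : (of (a * b) : CStar A) = of a * of b := by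
  have h : Continuous fun p : PreEnvelope A × PreEnvelope A =>
      (of ((show A from p.1) * (show A from p.2)) : CStar A) :=
    (isDenseInducing_of (A := A)).continuous.comp (_root_.continuous_mul (M := PreEnvelope A))
  exact (IsDenseInducing.extend_eq _ h (a, b)).symm

variable {A} in
theorem of_add (a b : A) : (of (a + b) : CStar A) = of a + of b :=
  Completion.coe_add (α := PreEnvelope A) a b

variable {A} in
theorem of_smul (c : ℂ) (a : A) : (of (c • a) : CStar A) = c • of a :=
  Completion.coe_smul (X := PreEnvelope A) c a

variable {A} in
theorem norm_of (a : A) : ‖(of a : CStar A)‖ = envNorm a :=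
  Completion.norm_coe (E := PreEnvelope A) a

variable {A} in
theorem ind₁ {p : CStar A → Prop} (x : CStar A) (hp : IsClosed {x | p x})
    (h : ∀ a : A, p (of a)) : p x := Completion.induction_on x hp h

variable {A} in
theorem ind₂ {p : CStar A → CStar A → Prop} (x y : CStar A)
    (hp : IsClosed {q : CStar A × CStar A | p q.1 q.2}) (h : ∀ a b : A, p (of a) (of b)) : p x y :=
  Completion.induction_on₂ x y hp h

variable {A} in
theorem ind₃ {p : CStar A → CStar A → CStar A → Prop} (x y z : CStar A)
    (hp : IsClosed {q : CStar A × CStar A × CStar A | p q.1 q.2.1 q.2.2})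
    (h : ∀ a b c : A, p (of a) (of b) (of c)) : p x y z :=
  Completion.induction_on₃ x y z hp h

instance : NonUnitalNormedRing (CStar A) where
  zero_mul := fun x => by
    refine ind₁ (p := fun x : CStar A => 0 * x = 0) x (isClosed_eq (by fun_prop) (by fun_prop))
      fun a => ?_
    have : (0 : CStar A) = of 0 := rfl
    rw [this, ← of_mul, zero_mul]
  mul_zero := fun x => by
    refine ind₁ (p := fun x : CStar A => x * 0 = 0) x (isClosed_eq (by fun_prop) (by fun_prop))
      fun a => ?_
    have : (0 : CStar A) = of 0 := rfl
    rw [this, ← of_mul, mul_zero]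
  left_distrib := fun x y z => by
    refine ind₃ (p := fun x y z : CStar A => x * (y + z) = x * y + x * z) x y z
      (isClosed_eq (by fun_prop) (by fun_prop)) fun a b c => ?_
    simp only [← of_mul, ← of_add, mul_add]
  right_distrib := fun x y z => by
    refine ind₃ (p := fun x y z : CStar A => (x + y) * z = x * z + y * z) x y z
      (isClosed_eq (by fun_prop) (by fun_prop)) fun a b c => ?_
    simp only [← of_mul, ← of_add, add_mul]
  mul_assoc := fun x y z => by
    refine ind₃ (p := fun x y z : CStar A => x * y * z = x * (y * z)) x y z
      (isClosed_eq (by fun_prop) (by fun_prop)) fun a b c => ?_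
    simp only [← of_mul, mul_assoc]
  dist_eq := NormedAddCommGroup.dist_eq
  norm_mul_le := fun x y => by
    refine ind₂ (p := fun x y : CStar A => ‖x * y‖ ≤ ‖x‖ * ‖y‖) x y
      (isClosed_le (by fun_prop) (by fun_prop)) fun a b => ?_
    rw [← of_mul, norm_of, norm_of, norm_of]
    exact norm_mul_le (α := PreEnvelope A) a b

instance : IsScalarTower ℂ (CStar A) (CStar A) := ⟨fun c x y => by
  refine ind₂ (p := fun x y : CStar A => (c • x) * y = c • (x * y)) x y
    (isClosed_eq (((continuous_const_smul c).comp continuous_fst).mul continuous_snd)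
      ((continuous_const_smul c).comp (continuous_mul A))) fun a b => ?_
  simp only [← of_mul, ← of_smul, smul_mul_assoc]⟩

instance : SMulCommClass ℂ (CStar A) (CStar A) := ⟨fun c x y => by
  refine ind₂ (p := fun x y : CStar A => c • (x * y) = x * (c • y)) x y
    (isClosed_eq ((continuous_const_smul c).comp (continuous_mul A))
      (continuous_fst.mul ((continuous_const_smul c).comp continuous_snd))) fun a b => ?_
  simp only [← of_mul, ← of_smul, mul_smul_comm]⟩

/-- The involution of `C*(A)`, extended by continuity from `A`. -/
instance : Star (CStar A) := ⟨Completion.map (star : PreEnvelope A → PreEnvelope A)⟩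

variable {A} in
theorem of_star (a : A) : (of (star a) : CStar A) = star (of a) :=
  (Completion.map_coe (starₗᵢ ℂ (E := PreEnvelope A)).isometry.uniformContinuous a).symm

instance : ContinuousStar (CStar A) :=
  ⟨Completion.continuous_map (f := (star : PreEnvelope A → PreEnvelope A))⟩

instance : StarRing (CStar A) where
  star_involutive := fun x => by
    refine ind₁ (p := fun x : CStar A => star (star x) = x) x
      (isClosed_eq (by fun_prop) (by fun_prop)) fun a => ?_
    rw [← of_star, ← of_star, star_star]
  star_mul := fun x y => by
    refine ind₂ (p := fun x y : CStar A => star (x * y) = star y * star x) x y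
      (isClosed_eq (by fun_prop) (by fun_prop)) fun a b => ?_
    simp only [← of_mul, ← of_star, star_mul]
  star_add := fun x y => by
    refine ind₂ (p := fun x y : CStar A => star (x + y) = star x + star y) x y
      (isClosed_eq (by fun_prop) (by fun_prop)) fun a b => ?_
    simp only [← of_add, ← of_star, star_add]

instance : StarModule ℂ (CStar A) := ⟨fun c x => by
  refine ind₁ (p := fun x : CStar A => star (c • x) = star c • star x) x
    (isClosed_eq (continuous_star.comp (continuous_const_smul c))
      ((continuous_const_smul (star c)).comp continuous_star)) fun a => ?_
  simp only [← of_smul, ← of_star, star_smul]⟩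

instance : CStarRing (CStar A) := ⟨fun x => by
  refine ind₁ (p := fun x : CStar A => ‖x‖ * ‖x‖ ≤ ‖star x * x‖) x
    (isClosed_le (by fun_prop) (by fun_prop)) fun a => ?_
  rw [← of_star, ← of_mul, norm_of, norm_of]
  exact envelope_norm_mul_self_le A a⟩

instance : NonUnitalCStarAlgebra (CStar A) where
  star_smul := star_smul

end CStar

/-- A closed two-sided ideal. -/
structure IsClosedIdeal {B : Type*} [NonUnitalNormedRing B] [NormedSpace ℂ B] (I : Submodule ℂ B) :
    Prop where
  isClosed : IsClosed (I : Set B)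
  mul_mem_left : ∀ (b : B) {x : B}, x ∈ I → b * x ∈ I
  mul_mem_right : ∀ (b : B) {x : B}, x ∈ I → x * b ∈ I

variable {A} in
/-- `I' = I ∩ A`: the preimage of `I` under the natural map `A → C*(A)`. -/
def trace (I : Submodule ℂ (CStar A)) : Set A := {a | CStar.of a ∈ I}

variable {A} in
/-- The closed ideal `I` of `C*(A)` is `A`-determined: for all closed ideals `J` of `C*(A)`,
`I ∩ A ⊆ J ∩ A` implies `I ⊆ J`. -/
structure IsDetermined (I : Submodule ℂ (CStar A)) : Prop where
  isClosedIdeal : IsClosedIdeal I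
  le_of_trace_subset : ∀ J : Submodule ℂ (CStar A), IsClosedIdeal J → trace I ⊆ trace J → I ≤ J

/-- `A` is `*`-regular: every closed ideal of `C*(A)` is `A`-determined. -/
def IsStarRegular : Prop := ∀ I : Submodule ℂ (CStar A), IsClosedIdeal I → IsDetermined I

end envelope

section inducedIdeals
variable {G : Type u} [Group G] [TopologicalSpace G] [IsTopologicalGroup G] [LocallyCompactSpace G]
  [T2Space G] [MeasurableSpace G] [BorelSpace G] (H : Subgroup G) [IsClosed (H : Set G)]

instance locallyCompactSpace_of_isClosed : LocallyCompactSpace H :=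
  IsClosed.isClosedEmbedding_subtypeVal (inferInstance : IsClosed (H : Set G)) |>.locallyCompactSpace

variable {H} in
/-- The action `a ∗ f` of `a ∈ C*(H)` on `f ∈ C*(G)` from the left: the extension by continuity of
the convolution `(a ∗ f)(x) = ∫ a(h) f(h⁻¹ x) dh` of `a ∈ L¹(H)` and `f ∈ L¹(G)`. -/
def act (a : CStar (L1 H)) (f : CStar (L1 G)) : CStar (L1 G) :=
  ((CStar.isDenseInducing_of (A := L1 H)).prodMap (CStar.isDenseInducing_of (A := L1 G))).extend
    (fun p => CStar.of (show L1 G from conv (K := H) (G := G) p.1 p.2)) (a, f)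

variable {H} in
/-- The induced ideal `ind J = (C*(G) ∗ J ∗ C*(G))⁻`, a closed linear span. -/
def inducedIdeal (J : Submodule ℂ (CStar (L1 H))) : Submodule ℂ (CStar (L1 G)) :=
  (Submodule.span ℂ {x | ∃ f g : CStar (L1 G), ∃ a ∈ J, x = f * act a g}).topologicalClosure

/-- The ideal `I` of `C*(G)` is induced from `H`. -/
def IsInducedFrom (I : Submodule ℂ (CStar (L1 G))) : Prop :=
  ∃ J : Submodule ℂ (CStar (L1 H)), IsClosedIdeal J ∧ I = inducedIdeal J

end inducedIdeals

end GroupCStar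

end

/-!
Let `I` be induced from the ideal `J` of `C*(H)` and let `K` be an ideal of `C*(G)` with
`I ∩ L¹(G) ⊆ K ∩ L¹(G)`. The elements `a` of `C*(H)` with `a ∗ C*(G) ⊆ K` form a closed ideal
`restrictIdeal H K` of `C*(H)`. For `a ∈ J ∩ L¹(H)` and `f, g ∈ L¹(G)` the element `f ∗ (a ∗ g)` lies
in `I` and is a function in `L¹(G)`, so it lies in `K`; by density and an approximate unit of `C*(G)`,
`a` belongs to `restrictIdeal H K` (`trace_subset_trace_restrictIdeal`). As `H` is `*`-regular,
`J ⊆ restrictIdeal H K`, which says precisely that `I ⊆ K` (`inducedIdeal_le`).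

The analytic input is that convolution by `L¹(H)` is bounded on `L¹(G)` for the enveloping
`C*`-seminorms (`envNorm_conv_le`), so that the action of `C*(H)` on `C*(G)` is jointly continuous and
inherits its algebraic laws from the integrable functions. It rests on the adjoint relation
`(a⋆ ∗ g)⋆ ∗ f = g⋆ ∗ (a ∗ f)` (`conv_invol_conv`), obtained from two substitutions in Bochner
integrals. Given a representation `π` of `L¹(G)` and a vector `ξ`, this relation makes
`a ↦ π(a ∗ f) ξ` a Gelfand–Naimark–Segal map for a representation `ρ` of `L¹(H)` on the closure of its
range, and `‖π(a ∗ f) ξ‖² = ⟪π(f) ξ, ρ(a⋆) π(a ∗ f) ξ⟫` gives the bound (`envNorm_smul_le`). Working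
with a single `f` and `ξ` avoids extending `π` to the multiplier algebra.
-/

noncomputable section

namespace GroupCStar

/-! ### Adjoints of convolution operators -/

section adjoint
variable {G : Type*} [Group G] [TopologicalSpace G] [IsTopologicalGroup G] [LocallyCompactSpace G]
  [T2Space G] [MeasurableSpace G] [BorelSpace G]

theorem map_mul_right_haar (h : G) :
    map (· * h) (haar : Measure G) = modularCharacter h • (haar : Measure G) := by
  have : (map (· * h) (haar : Measure G)).Regular :=
    Regular.map (Homeomorph.mulRight h)
  rw [isMulLeftInvariant_eq_smul_of_regular (map (· * h) (haar : Measure G)) haar,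
    ← modularCharacterFun_eq_haarScalarFactor]
  rfl

theorem integral_comp_mul_right_haar {E : Type*} [NormedAddCommGroup E] [NormedSpace ℝ E]
    (F : G → E) (h : G) :
    ∫ x, F (x * h) ∂(haar : Measure G) = modularCharacter h • ∫ x, F x ∂(haar : Measure G) := by
  rw [← integral_smul_nnreal_measure, ← map_mul_right_haar]
  exact (integral_map_equiv (MeasurableEquiv.mulRight h) F).symm

theorem integral_comp_inv_haar {E : Type*} [NormedAddCommGroup E] [NormedSpace ℝ E]
    (F : G → E) :
    ∫ x, modularCharacter x • F x⁻¹ ∂(haar : Measure G) = ∫ x, F x ∂(haar : Measure G) := by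
  rw [← integral_withDensity_eq_integral_smul continuous_modularCharacter.measurable,
    ← inv_haar_eq_withDensity, Measure.inv]
  have := integral_map_equiv (μ := (haar : Measure G)) (MeasurableEquiv.inv G) (fun x => F x⁻¹)
  simpa using this

/-- The real scalar multiplication of `Lp` is the restriction of the complex one
(the two structures come from different instances). -/
theorem real_smul_Lp {X : Type*} [MeasurableSpace X] {μ : Measure X} (c : ℝ) (f : Lp ℂ 1 μ) :
    c • f = (c : ℂ) • f := by
  refine Lp.ext ?_
  filter_upwards [Lp.coeFn_smul c f, Lp.coeFn_smul (c : ℂ) f] with x h1 h2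
  rw [h1, h2, Pi.smul_apply, Pi.smul_apply, Complex.coe_smul]

/-- Left translations are unitary for the `L¹(G)`-valued inner product `(g, f) ↦ g⋆ ∗ f`. -/
theorem conv_invol_translate (h : G) (g f : Lp ℂ 1 (haar : Measure G)) :
    conv (invol (translate h g)) f = conv (invol g) (translate h⁻¹ f) := by
  let F : G → Lp ℂ 1 (haar : Measure G) := fun m => involFun g m • translate (m * h⁻¹) f
  have hne : modularCharacter h ≠ 0 := (modularCharacterFun_pos h).ne'
  have h1 : conv (invol g) (translate h⁻¹ f) = ∫ m, F m ∂(haar : Measure G) := by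
    refine integral_congr_ae ?_
    filter_upwards [invol_coeFn g] with m hm
    rw [hm, ← translate_mul]
  have h2 : conv (invol (translate h g)) f
      = ∫ k, ((modularCharacter h : ℝ≥0) : ℂ)⁻¹ • F (k * h) ∂(haar : Measure G) := by
    refine integral_congr_ae ?_
    filter_upwards [invol_coeFn (translate h g), involFun_congr (translate_coeFn h g)] with k hk hk'
    have : (((modularCharacter h : ℝ≥0) : ℝ) : ℂ) ≠ 0 := by exact_mod_cast hne
    rw [hk, hk']
    simp only [F, mul_inv_cancel_right, involFun]
    rw [smul_smul, map_mul, mul_inv_rev, smul_eq_mul]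
    push_cast
    congr 1
    field_simp
  rw [h2, h1, integral_smul, integral_comp_mul_right_haar, NNReal.smul_def, real_smul_Lp, smul_smul,
    inv_mul_cancel₀ (by exact_mod_cast hne), one_smul]

/-- The involution of `L¹(G)` as a real-linear map, to be exchanged with Bochner integrals. -/
def involL : Lp ℂ 1 (haar : Measure G) →L[ℝ] Lp ℂ 1 (haar : Measure G) where
  toFun := invol
  map_add' := invol_add
  map_smul' := fun c f => by
    rw [real_smul_Lp, real_smul_Lp, invol_smul, Complex.conj_ofReal]
    rfl
  cont := continuous_invol

variable {H : Subgroup G} [IsClosed (H : Set G)]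

theorem translate_coe (h : H) (f : Lp ℂ 1 (haar : Measure G)) :
    translate h f = translate (h : G) f := by
  refine Lp.ext ?_
  filter_upwards [translate_coeFn h f, translate_coeFn (h : G) f] with x h1 h2
  rw [h1, h2]
  rfl

/-- The adjoint of convolution by `a` for the inner product `(g, f) ↦ g⋆ ∗ f` is convolution
by `a⋆`. -/
theorem conv_invol_conv (a : Lp ℂ 1 (haar : Measure H))
    (g f : Lp ℂ 1 (haar : Measure G)) :
    conv (invol (conv (invol a) g)) f = conv (invol g) (conv a f) := by
  let F : H → Lp ℂ 1 (haar : Measure G) := fun h => a h • conv (invol g) (translate h f)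
  have h1 : conv (invol g) (conv a f) = ∫ h, F h ∂(haar : Measure H) := by
    have := (convL (K := G) (G := G) (invol g)).integral_comp_comm (integrable_conv a f)
    simp only [map_smul] at this
    exact this.symm
  have h2 : conv (invol (conv (invol a) g)) f
      = ∫ h, conv (invol (invol a h • translate h g)) f ∂(haar : Measure H) :=
    ((((convL (K := G) (G := G)).flip f).restrictScalars ℝ ∘L involL).integral_comp_comm
      (integrable_conv (invol a) g)).symm
  rw [h1, h2, ← integral_comp_inv_haar]
  refine integral_congr_ae ?_
  -- Applied to `a = (a⋆)⋆`, this expresses `a h` through `a⋆ h⁻¹`, as it occurs after `h ↦ h⁻¹`.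
  filter_upwards [invol_coeFn (invol a)] with h hh
  rw [invol_invol] at hh
  simp only [F, hh, involFun, invol_smul, smul_conv, NNReal.smul_def, translate_coe,
    conv_invol_translate, InvMemClass.coe_inv]
  rw [real_smul_Lp, smul_smul]
  simp

/-- Left convolution by `L¹(H)` commutes with right convolution by `L¹(G)`. -/
theorem conv_conv_right (a : Lp ℂ 1 (haar : Measure H))
    (f g : Lp ℂ 1 (haar : Measure G)) : conv (conv a f) g = conv a (conv f g) := by
  have := ((convL (K := G) (G := G)).flip g).integral_comp_comm (integrable_conv a f)
  change _ = conv (conv a f) g at this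
  rw [← this, conv]
  refine integral_congr_ae (ae_of_all _ fun k => ?_)
  change conv (a k • translate k f) g = _
  rw [smul_conv, translate_coe, conv_translate, ← translate_coe]

end adjoint

/-! ### Boundedness for the enveloping seminorm -/

section module
variable {A : Type u} [NonUnitalNormedRing A] [NormedSpace ℂ A] [IsScalarTower ℂ A A]
  [SMulCommClass ℂ A A] [StarRing A] [NormedStarGroup A] [StarModule ℂ A] [CompleteSpace A]
  {E : Type u} [NormedAddCommGroup E] [InnerProductSpace ℂ E] [CompleteSpace E]

open scoped InnerProductSpace

/-- Left multiplication by `c` is bounded by `‖c‖` for the seminorm `b ↦ ‖Λ b‖`. Iterating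
`‖Λ (c b)‖² ≤ ‖Λ b‖ ‖Λ (c⋆ c b)‖` improves the crude bound by `M` to this one. -/
theorem norm_apply_mul_le (Λ : A →ₗ[ℂ] E) (M : ℝ) (hM : ∀ a, ‖Λ a‖ ≤ M * ‖a‖)
    (hΛ : ∀ a b c, ⟪Λ (a * b), Λ c⟫_ℂ = ⟪Λ b, Λ (star a * c)⟫_ℂ) (c b : A) :
    ‖Λ (c * b)‖ ≤ ‖c‖ * ‖Λ b‖ := by
  have hsq : ∀ c : A, ‖Λ (c * b)‖ ^ 2 ≤ ‖Λ b‖ * ‖Λ (star c * c * b)‖ := by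
    intro c
    have h1 : ‖Λ (c * b)‖ ^ 2 = ‖⟪Λ (c * b), Λ (c * b)⟫_ℂ‖ := by
      rw [inner_self_eq_norm_sq_to_K]
      simp
    rw [h1, hΛ, ← mul_assoc]
    exact norm_inner_le_norm _ _
  rcases (norm_nonneg (Λ b)).eq_or_lt with h0 | h0
  · have := hsq c
    rw [← h0, zero_mul] at this
    rw [← h0, mul_zero]
    exact (pow_eq_zero_iff two_ne_zero).1 (le_antisymm this (sq_nonneg _)) |>.le
  have hiter : ∀ n : ℕ, ∀ c : A,
      ‖Λ (c * b)‖ ^ (2 ^ n) * ‖Λ b‖ ≤ (‖c‖ * ‖Λ b‖) ^ (2 ^ n) * (|M| * ‖b‖) := by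
    intro n
    induction n with
    | zero =>
      intro c
      have h1 : ‖Λ (c * b)‖ ≤ |M| * (‖c‖ * ‖b‖) :=
        (hM _).trans (mul_le_mul (le_abs_self M) (norm_mul_le _ _) (norm_nonneg _) (abs_nonneg _))
      calc _ ≤ (|M| * (‖c‖ * ‖b‖)) * ‖Λ b‖ := by simpa using by gcongr
        _ = _ := by ring
    | succ n ih =>
      intro c
      have h1 : ‖star c * c‖ ≤ ‖c‖ * ‖c‖ := (norm_mul_le _ _).trans (by rw [norm_star])
      calc ‖Λ (c * b)‖ ^ 2 ^ (n + 1) * ‖Λ b‖ = (‖Λ (c * b)‖ ^ 2) ^ 2 ^ n * ‖Λ b‖ := by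
            rw [← pow_mul, pow_succ' 2 n]
        _ ≤ (‖Λ b‖ * ‖Λ (star c * c * b)‖) ^ 2 ^ n * ‖Λ b‖ := by gcongr; exact hsq c
        _ = ‖Λ b‖ ^ 2 ^ n * (‖Λ (star c * c * b)‖ ^ 2 ^ n * ‖Λ b‖) := by ring
        _ ≤ ‖Λ b‖ ^ 2 ^ n * ((‖star c * c‖ * ‖Λ b‖) ^ 2 ^ n * (|M| * ‖b‖)) := by
            gcongr ?_ * ?_
            exact ih _
        _ ≤ ‖Λ b‖ ^ 2 ^ n * ((‖c‖ * ‖c‖ * ‖Λ b‖) ^ 2 ^ n * (|M| * ‖b‖)) := by gcongr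
        _ = (‖c‖ * ‖Λ b‖) ^ 2 ^ (n + 1) * (|M| * ‖b‖) := by
            rw [pow_succ' 2 n, pow_mul]; ring
  -- Otherwise the ratio of the two sides exceeds one, and its powers `2 ^ n` are unbounded,
  -- against `hiter`.
  by_contra! hlt
  have hp : 0 < ‖Λ (c * b)‖ := (by positivity : 0 ≤ ‖c‖ * ‖Λ b‖).trans_lt hlt
  rcases (by positivity : 0 ≤ ‖c‖ * ‖Λ b‖).eq_or_lt with h2 | h2
  · have := hiter 0 c
    rw [← h2] at this
    simp only [pow_zero, pow_one, zero_mul] at this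
    exact absurd this (not_le.2 (by positivity))
  have hr : 1 < ‖Λ (c * b)‖ / (‖c‖ * ‖Λ b‖) := (one_lt_div h2).2 hlt
  obtain ⟨n, hn⟩ := pow_unbounded_of_one_lt (|M| * ‖b‖ / ‖Λ b‖) hr
  have h3 : (‖Λ (c * b)‖ / (‖c‖ * ‖Λ b‖)) ^ 2 ^ n ≤ |M| * ‖b‖ / ‖Λ b‖ := by
    rw [div_pow, div_le_div_iff₀ (by positivity) h0, mul_comm (|M| * ‖b‖)]
    exact hiter n c
  exact absurd (hn.trans_le ((pow_le_pow_right₀ hr.le Nat.lt_two_pow_self.le).trans h3)) (lt_irrefl _)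

/-- The Gelfand–Naimark–Segal construction: a map `Λ : A → E` which intertwines left multiplication
with the involution carries a `*`-representation of `A` on the closure of its range. -/
theorem exists_hilbertRep (Λ : A →ₗ[ℂ] E) (M : ℝ) (hM : ∀ a, ‖Λ a‖ ≤ M * ‖a‖)
    (hΛ : ∀ a b c, ⟪Λ (a * b), Λ c⟫_ℂ = ⟪Λ b, Λ (star a * c)⟫_ℂ) :
    ∃ r : HilbertRep A, ∀ a b, ‖Λ (a * b)‖ ≤ ‖r.rep a‖ * ‖Λ b‖ := by
  let W : Submodule ℂ E := (LinearMap.range Λ).topologicalClosure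
  have : CompleteSpace W := (Submodule.isClosed_topologicalClosure _).completeSpace_coe
  let e : A →ₗ[ℂ] W := Λ.codRestrict W fun a => Submodule.le_topologicalClosure _ ⟨a, rfl⟩
  have he : ∀ a, (e a : E) = Λ a := fun a => rfl
  have hd : DenseRange e := by
    rw [DenseRange, Subtype.dense_iff]
    intro x hx
    rw [← range_comp]
    exact hx
  have hb : ∀ a b, ‖(e ∘ₗ LinearMap.mulLeft ℂ a) b‖ ≤ ‖a‖ * ‖e b‖ := fun a b =>
    norm_apply_mul_le Λ M hM hΛ a b
  let T : A → W →L[ℂ] W := fun a => (e ∘ₗ LinearMap.mulLeft ℂ a).extendOfNorm e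
  have hT : ∀ a b, T a (e b) = e (a * b) := fun a b =>
    LinearMap.extendOfNorm_eq hd ⟨‖a‖, hb a⟩ b
  have hext : ∀ S S' : W →L[ℂ] W, (∀ b, S (e b) = S' (e b)) → S = S' := fun S S' h =>
    DFunLike.coe_injective (hd.equalizer S.continuous S'.continuous (funext h))
  have hstar : ∀ a, T (star a) = star (T a) := by
    intro a
    rw [ContinuousLinearMap.star_eq_adjoint, ContinuousLinearMap.eq_adjoint_iff]
    intro x y
    refine hd.induction_on₂ (p := fun x y => ⟪T (star a) x, y⟫_ℂ = ⟪x, T a y⟫_ℂ)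
      (isClosed_eq (by fun_prop) (by fun_prop)) (fun b c => ?_) x y
    rw [hT, hT, Submodule.coe_inner, Submodule.coe_inner, he, he, he, he, hΛ, star_star]
  refine ⟨{ carrier := W
            rep :=
              { toFun := T
                map_smul' := fun c a => hext _ _ fun b => by
                  change T (c • a) (e b) = c • T a (e b)
                  rw [hT, hT, smul_mul_assoc, map_smul]
                map_zero' := hext _ _ fun b => by simp [hT]
                map_add' := fun a a' => hext _ _ fun b => by
                  rw [_root_.add_apply, hT, hT, hT, add_mul, map_add]
                map_mul' := fun a a' => hext _ _ fun b => by
                  rw [mul_apply_eq_comp, hT, hT, hT, mul_assoc]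
                map_star' := hstar } }, fun a b => ?_⟩
  have := (T a).le_opNorm (e b)
  rw [hT] at this
  exact this

/-- If `A` acts on `B` by bounded operators which are adjointable for the `B`-valued inner product
`(g, f) ↦ g⋆ f`, the action is bounded by the enveloping `C*`-seminorms. For a representation `π` of
`B` and a vector `ξ`, the map `a ↦ π (a • f) ξ` carries a representation of `A`. -/
theorem envNorm_smul_le {B : Type u} [NonUnitalNormedRing B] [NormedSpace ℂ B] [IsScalarTower ℂ B B]
    [SMulCommClass ℂ B B] [StarRing B] [NormedStarGroup B] [StarModule ℂ B] [CompleteSpace B]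
    (m : A →ₗ[ℂ] B →ₗ[ℂ] B) (hm : ∀ a f, ‖m a f‖ ≤ ‖a‖ * ‖f‖)
    (hmul : ∀ a b f, m (a * b) f = m a (m b f))
    (hadj : ∀ a g f, star (m (star a) g) * f = star g * m a f) (a : A) (f : B) :
    envNorm (m a f) ≤ envNorm a * envNorm f := by
  refine Real.iSup_le (fun r => ?_) (mul_nonneg (envNorm_nonneg _) (envNorm_nonneg _))
  refine ContinuousLinearMap.opNorm_le_bound _
    (mul_nonneg (envNorm_nonneg _) (envNorm_nonneg _)) fun ξ => ?_
  let Λ : A →ₗ[ℂ] r.carrier :=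
    { toFun := fun a => r.rep (m a f) ξ
      map_add' := fun a b => by simp
      map_smul' := fun c a => by simp }
  have hin : ∀ (g h : B), ⟪r.rep g ξ, r.rep h ξ⟫_ℂ = ⟪ξ, r.rep (star g * h) ξ⟫_ℂ := by
    intro g h
    rw [map_mul, map_star, mul_apply_eq_comp, ContinuousLinearMap.star_eq_adjoint,
      ContinuousLinearMap.adjoint_inner_right]
  have hΛ : ∀ a b c, ⟪Λ (a * b), Λ c⟫_ℂ = ⟪Λ b, Λ (star a * c)⟫_ℂ := by
    intro a b c
    change ⟪r.rep (m (a * b) f) ξ, r.rep (m c f) ξ⟫_ℂ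
      = ⟪r.rep (m b f) ξ, r.rep (m (star a * c) f) ξ⟫_ℂ
    rw [hin, hin, hmul, hmul, ← hadj (star a), star_star]
  have hM : ∀ a, ‖Λ a‖ ≤ ‖f‖ * ‖ξ‖ * ‖a‖ := fun a =>
    calc ‖Λ a‖ ≤ ‖r.rep (m a f)‖ * ‖ξ‖ := ContinuousLinearMap.le_opNorm _ _
      _ ≤ (‖a‖ * ‖f‖) * ‖ξ‖ := by gcongr; exact (r.norm_le _).trans (hm a f)
      _ = _ := by ring
  obtain ⟨ρ, hρ⟩ := exists_hilbertRep Λ _ hM hΛ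
  have hstar : ‖ρ.rep (star a)‖ ≤ envNorm a := by
    rw [map_star, norm_star]
    exact ρ.le_envNorm a
  -- `π (f) ξ` need not lie in the range of `Λ`; only `Λ a` is compared with it.
  have hsq : ‖Λ a‖ * ‖Λ a‖ ≤ envNorm a * (envNorm f * ‖ξ‖) * ‖Λ a‖ := by
    -- The adjoint relation moves one factor `a` across, leaving `π (f) ξ` on the left.
    have h1 : ⟪Λ a, Λ a⟫_ℂ = ⟪r.rep f ξ, Λ (star a * a)⟫_ℂ := by
      change ⟪r.rep (m a f) ξ, r.rep (m a f) ξ⟫_ℂ = ⟪r.rep f ξ, r.rep (m (star a * a) f) ξ⟫_ℂ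
      rw [hin, hin, hmul, ← hadj (star a), star_star]
    calc ‖Λ a‖ * ‖Λ a‖ = ‖⟪r.rep f ξ, Λ (star a * a)⟫_ℂ‖ := by
          rw [← h1, inner_self_eq_norm_sq_to_K]
          simp [sq]
      _ ≤ ‖r.rep f ξ‖ * ‖Λ (star a * a)‖ := norm_inner_le_norm _ _
      _ ≤ (envNorm f * ‖ξ‖) * (envNorm a * ‖Λ a‖) := by
          refine mul_le_mul ?_ ((hρ _ _).trans (by gcongr)) (norm_nonneg _)
            (mul_nonneg (envNorm_nonneg _) (norm_nonneg _))
          exact (ContinuousLinearMap.le_opNorm _ _).trans (by gcongr; exact r.le_envNorm f)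
      _ = _ := by ring
  change ‖Λ a‖ ≤ _
  rw [mul_assoc]
  rcases (norm_nonneg (Λ a)).eq_or_lt with h | h
  · rw [← h]
    exact mul_nonneg (envNorm_nonneg _) (mul_nonneg (envNorm_nonneg _) (norm_nonneg _))
  · exact le_of_mul_le_mul_right hsq h

end module

/-! ### Ideals and approximate units -/

section approximateUnit
variable {B : Type*} [NonUnitalCStarAlgebra B]

theorem exists_isApproximateUnit : ∃ l : Filter B, l.IsApproximateUnit := by
  let := CStarAlgebra.spectralOrder B
  have := CStarAlgebra.spectralOrderedRing B
  exact ⟨_, (CStarAlgebra.increasingApproximateUnit B).toIsApproximateUnit⟩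

theorem IsClosedIdeal.mem_of_forall_mul_mem {K : Submodule ℂ B} (hK : IsClosedIdeal K) {x : B}
    (h : ∀ b, b * x ∈ K) : x ∈ K := by
  obtain ⟨l, hl⟩ := exists_isApproximateUnit (B := B)
  have := hl.neBot
  exact hK.isClosed.mem_of_tendsto (hl.tendsto_mul_right x) (Eventually.of_forall h)

end approximateUnit

/-! ### The action of `C*(H)` on `C*(G)` -/

section action
variable {G : Type u} [Group G] [TopologicalSpace G] [IsTopologicalGroup G] [LocallyCompactSpace G]
  [T2Space G] [MeasurableSpace G] [BorelSpace G] {H : Subgroup G} [IsClosed (H : Set G)]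

variable (H) in
/-- The convolution action of `L¹(H)` on `L¹(G)` as a bilinear map. -/
def convₗ : L1 H →ₗ[ℂ] L1 G →ₗ[ℂ] L1 G :=
  LinearMap.mk₂ ℂ (conv (K := H) (G := G)) add_conv smul_conv conv_add fun c a f => conv_smul a c f

theorem envNorm_conv_le (a : L1 H) (f : L1 G) :
    envNorm (convₗ H a f) ≤ envNorm a * envNorm f :=
  envNorm_smul_le (convₗ H) (fun a f => norm_conv_le (K := H) (G := G) a f)
    (fun a b f => conv_assoc (K := H) (G := G) a b f)
    (fun a g f => conv_invol_conv (H := H) (G := G) a g f) a f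

variable (H G) in
/-- Convolution as a bilinear map on `L¹(H) × L¹(G)`, with the enveloping `C*`-seminorms, with values
in `C*(G)`. -/
def convCStar : PreEnvelope (L1 H) →L[ℂ] PreEnvelope (L1 G) →L[ℂ] CStar (L1 G) :=
  LinearMap.mkContinuous₂ (LinearMap.mk₂ ℂ (fun a f => CStar.of (convₗ H a f))
    (fun a b f => (congrArg CStar.of ((convₗ H).map_add₂ a b f)).trans (CStar.of_add _ _))
    (fun c a f => (congrArg CStar.of ((convₗ H).map_smul₂ c a f)).trans (CStar.of_smul _ _))
    (fun a f g => (congrArg CStar.of ((convₗ H a).map_add f g)).trans (CStar.of_add _ _))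
    (fun c a f => (congrArg CStar.of ((convₗ H a).map_smul c f)).trans (CStar.of_smul _ _))) 1
    fun a f => by
      rw [one_mul]
      exact (CStar.norm_of _).le.trans (envNorm_conv_le (H := H) (G := G) a f)

theorem continuous_convCStar :
    Continuous fun p : PreEnvelope (L1 H) × PreEnvelope (L1 G) => convCStar G H p.1 p.2 :=
  (convCStar G H).continuous₂

theorem act_of_of (a : L1 H) (f : L1 G) :
    act (CStar.of a) (CStar.of f) = CStar.of (convₗ H a f) :=
  IsDenseInducing.extend_eq _ continuous_convCStar (a, f)

theorem continuous_act : Continuous fun p : CStar (L1 H) × CStar (L1 G) => act p.1 p.2 := by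
  let m : PreEnvelope (L1 H) →+ PreEnvelope (L1 G) →+ CStar (L1 G) :=
    AddMonoidHom.mk' (fun a => (convCStar G H a : PreEnvelope (L1 G) →+ CStar (L1 G))) fun a b => by
      ext f
      exact DFunLike.congr_fun (map_add (convCStar G H) a b) f
  have hm : Continuous fun p : PreEnvelope (L1 H) × PreEnvelope (L1 G) => m p.1 p.2 :=
    continuous_convCStar
  have d₁ : IsDenseInducing (UniformSpace.Completion.toCompl :
      PreEnvelope (L1 H) → UniformSpace.Completion (PreEnvelope (L1 H))) :=
    UniformSpace.Completion.isDenseInducing_coe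
  have d₂ : IsDenseInducing (UniformSpace.Completion.toCompl :
      PreEnvelope (L1 G) → UniformSpace.Completion (PreEnvelope (L1 G))) :=
    UniformSpace.Completion.isDenseInducing_coe
  exact (d₁.extend_Z_bilin d₂ hm :)

theorem continuous_act_left (g : CStar (L1 G)) : Continuous fun a : CStar (L1 H) => act a g :=
  continuous_act.comp (by fun_prop : Continuous fun a : CStar (L1 H) => (a, g))

theorem continuous_act_right (a : CStar (L1 H)) : Continuous fun g : CStar (L1 G) => act a g :=
  continuous_act.comp (by fun_prop : Continuous fun g : CStar (L1 G) => (a, g))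

theorem add_act (a b : CStar (L1 H)) (f : CStar (L1 G)) : act (a + b) f = act a f + act b f := by
  refine CStar.ind₁ (p := fun f => act (a + b) f = act a f + act b f) f (isClosed_eq (continuous_act_right _)
    ((continuous_act_right a).add (continuous_act_right b))) fun f => ?_
  refine CStar.ind₂ (p := fun a b => act (a + b) (CStar.of f) = act a (CStar.of f) + act b (CStar.of f)) a b
     (isClosed_eq ((continuous_act_left _).comp continuous_add)
    (((continuous_act_left _).comp continuous_fst).add
      ((continuous_act_left _).comp continuous_snd))) fun a b => ?_
  rw [← CStar.of_add, act_of_of, act_of_of, act_of_of, ← CStar.of_add, LinearMap.map_add₂]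

theorem smul_act (c : ℂ) (a : CStar (L1 H)) (f : CStar (L1 G)) : act (c • a) f = c • act a f := by
  refine CStar.ind₁ (p := fun f => act (c • a) f = c • act a f) f (isClosed_eq (continuous_act_right _)
    ((continuous_act_right a).const_smul c)) fun f => ?_
  refine CStar.ind₁ (p := fun a => act (c • a) (CStar.of f) = c • act a (CStar.of f)) a
     (isClosed_eq ((continuous_act_left _).comp (continuous_const_smul c))
    ((continuous_act_left _).const_smul c)) fun a => ?_
  rw [← CStar.of_smul, act_of_of, act_of_of, ← CStar.of_smul, LinearMap.map_smul₂]

theorem mul_act (a b : CStar (L1 H)) (f : CStar (L1 G)) : act (a * b) f = act a (act b f) := by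
  refine CStar.ind₁ (p := fun f => act (a * b) f = act a (act b f)) f (isClosed_eq (continuous_act_right _)
    ((continuous_act_right a).comp (continuous_act_right b))) fun f => ?_
  refine CStar.ind₂ (p := fun a b => act (a * b) (CStar.of f) = act a (act b (CStar.of f))) a b
     (isClosed_eq ((continuous_act_left _).comp (CStar.continuous_mul _))
    (continuous_act.comp (continuous_fst.prodMk
      ((continuous_act_left _).comp continuous_snd)))) fun a b => ?_
  rw [← CStar.of_mul, act_of_of, act_of_of, act_of_of]
  exact congrArg CStar.of (conv_assoc (K := H) (G := G) a b f)

theorem act_mul (a : CStar (L1 H)) (f g : CStar (L1 G)) : act a (f * g) = act a f * g := by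
  refine CStar.ind₁ (p := fun a => act a (f * g) = act a f * g) a (isClosed_eq (continuous_act_left _)
    ((continuous_act_left _).mul continuous_const)) fun a => ?_
  refine CStar.ind₂ (p := fun f g => act (CStar.of a) (f * g) = act (CStar.of a) f * g) f g
     (isClosed_eq ((continuous_act_right _).comp (CStar.continuous_mul _))
    (((continuous_act_right _).comp continuous_fst).mul continuous_snd)) fun f g => ?_
  rw [← CStar.of_mul, act_of_of, act_of_of, ← CStar.of_mul]
  exact congrArg CStar.of (conv_conv_right (H := H) (G := G) a f g).symm

/-- Ideals of `C*(G)` are stable under the action of `C*(H)`: an approximate unit `u` reduces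
`a ∗ x` to the products `(a ∗ u) x`. -/
theorem IsClosedIdeal.act_mem {K : Submodule ℂ (CStar (L1 G))} (hK : IsClosedIdeal K)
    (a : CStar (L1 H)) {x : CStar (L1 G)} (hx : x ∈ K) : act a x ∈ K := by
  obtain ⟨l, hl⟩ := exists_isApproximateUnit (B := CStar (L1 G))
  have := hl.neBot
  refine hK.isClosed.mem_of_tendsto
    (((continuous_act_right a).tendsto x).comp (hl.tendsto_mul_right x)) (Eventually.of_forall ?_)
  intro u
  rw [Function.comp_apply, act_mul]
  exact hK.mul_mem_left _ hx

/-! ### Restriction and induction of ideals -/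

variable (H) in
/-- The restriction to `H` of an ideal `K` of `C*(G)`: the elements of `C*(H)` which map `C*(G)`
into `K`. -/
def restrictIdeal (K : Submodule ℂ (CStar (L1 G))) : Submodule ℂ (CStar (L1 H)) where
  carrier := {a | ∀ g, act a g ∈ K}
  add_mem' := fun ha hb g => by
    rw [add_act]
    exact K.add_mem (ha g) (hb g)
  zero_mem' := fun g => by
    rw [← zero_smul ℂ (0 : CStar (L1 H)), smul_act, zero_smul]
    exact K.zero_mem
  smul_mem' := fun c a ha g => by
    rw [smul_act]
    exact K.smul_mem c (ha g)

theorem isClosedIdeal_restrictIdeal {K : Submodule ℂ (CStar (L1 G))} (hK : IsClosedIdeal K) :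
    IsClosedIdeal (restrictIdeal H K) where
  isClosed := by
    change IsClosed {a : CStar (L1 H) | ∀ g, act a g ∈ K}
    rw [ofPred_forall]
    exact isClosed_iInter fun g => hK.isClosed.preimage (continuous_act_left g)
  mul_mem_left := fun b a ha g => by
    rw [mul_act]
    exact hK.act_mem b (ha g)
  mul_mem_right := fun b a ha g => by
    rw [mul_act]
    exact ha _

/-- The functions `f ∗ (a ∗ g)` with `f, g ∈ L¹(G)` and `a ∈ J ∩ L¹(H)` lie in `L¹(G)`, so
they already lie in `K` when `ind J ∩ L¹(G) ⊆ K`. -/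
theorem trace_subset_trace_restrictIdeal {J : Submodule ℂ (CStar (L1 H))}
    {K : Submodule ℂ (CStar (L1 G))} (hK : IsClosedIdeal K)
    (h : trace (inducedIdeal J) ⊆ trace K) : trace J ⊆ trace (restrictIdeal H K) := by
  intro a ha g
  refine hK.mem_of_forall_mul_mem fun f => ?_
  refine CStar.ind₂ (p := fun f g => f * act (CStar.of a) g ∈ K) f g (hK.isClosed.preimage
    (continuous_fst.mul ((continuous_act_right _).comp continuous_snd))) fun f g => ?_
  have hmem : f * convₗ H a g ∈ trace (inducedIdeal J) :=
    Submodule.le_topologicalClosure _ (Submodule.subset_span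
      ⟨CStar.of f, CStar.of g, CStar.of a, ha, by rw [act_of_of, CStar.of_mul]⟩)
  have := h hmem
  rwa [trace, mem_ofPred_eq, CStar.of_mul, ← act_of_of] at this

theorem inducedIdeal_le {J : Submodule ℂ (CStar (L1 H))} {K : Submodule ℂ (CStar (L1 G))}
    (hK : IsClosedIdeal K) (h : J ≤ restrictIdeal H K) : inducedIdeal J ≤ K := by
  refine Submodule.topologicalClosure_minimal _ (Submodule.span_le.2 ?_) hK.isClosed
  rintro _ ⟨f, g, a, ha, rfl⟩
  exact hK.mul_mem_left f (h ha g)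

end action
end GroupCStar

end

theorem mainTheorem2 {G : Type u} [Group G] [TopologicalSpace G] [IsTopologicalGroup G]
    [LocallyCompactSpace G] [T2Space G] [MeasurableSpace G] [BorelSpace G]
    (H : Subgroup G) [IsClosed (H : Set G)]
    (hH : GroupCStar.IsStarRegular (GroupCStar.L1 H))
    (I : Submodule ℂ (GroupCStar.CStar (GroupCStar.L1 G)))
    (hI : GroupCStar.IsClosedIdeal I) (hind : GroupCStar.IsInducedFrom H I) :
    GroupCStar.IsDetermined I := by
  obtain ⟨J, hJ, rfl⟩ := hind
  refine ⟨hI, fun K hK hIK => GroupCStar.inducedIdeal_le hK ?_⟩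
  exact (hH J hJ).le_of_trace_subset _ (GroupCStar.isClosedIdeal_restrictIdeal hK)
    (GroupCStar.trace_subset_trace_restrictIdeal hK hIK)
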